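/- All categories are small. A *symmetric monoidal category* (SMC) is a strict one: a category with a bifunctor $\otimes$ and an object $I$ that are associative and unital on the nose, and with a natural symmetry $\sigma_{A,B}\colon A\otimes B\to B\otimes A$ satisfying $\sigma_{A,I}=1_A$, $\sigma_{A,B\otimes C}=(1_B\otimes\sigma_{A,C})\circ(\sigma_{A,B}\otimes 1_C)$ and $\sigma_{B,A}\circ\sigma_{A,B}=1_{A\otimes B}$. An SMC-functor is a functor that strictly preserves $I$, $\otimes$ and $\sigma$. A *$\dagger$-SMC* is an SMC with an identity-on-objects, involutive, contravariant SMC-functor $(\cdot)^\dagger$; a $\dagger$-SMC-functor is an SMC-functor that commutes with the daggers. A morphism $f\colon A\to B$ of a $\dagger$-SMC is an *isometry* if $f^\dagger\circ f=1_A$; $\mathbf C_{\mathrm{iso}}$ denotes the SMC with the objects of $\mathbf C$ and the isometries of $\mathbf C$ as morphisms. A functor is *faithful* if it is injective on each hom-set, and *surjective* if it is surjective on objects and on each hom-set (that is, full). For an SMC $\mathbf E$, let $\mathbf E^!$ be its affine completion: the SMC with the same objects obtained by freely adding a morphism $!_A\colon A\to I$ for each object $A$, subject to $I$ being terminal. For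 a $\dagger$-SMC $\mathbf C$, let the discard construction $\mathbf C^{⏚}$ be the pushout of SMCs of $\mathbf C \leftarrow \mathbf C_{\mathrm{iso}}\to(\mathbf C_{\mathrm{iso}})^!$. Explicitly, it has the same objects as $\mathbf C$; its morphisms are the formal composites and tensor products of morphisms of $\mathbf C$ and of $(\mathbf C_{\mathrm{iso}})^!$, modulo the axioms of SMCs, the equations that hold in the two categories, and the identification of the two images of each isometry. A $\dagger$-SMC-functor $F\colon\mathbf C\to\mathbf D$ restricts to $F_{\mathrm{iso}}\colon\mathbf C_{\mathrm{iso}}\to\mathbf D_{\mathrm{iso}}$, which extends to $F_{\mathrm{iso}}^!\colon(\mathbf C_{\mathrm{iso}})^!\to(\mathbf D_{\mathrm{iso}})^!$ by $!_A\mapsto{!_{FA}}$; the pair $F$, $F_{\mathrm{iso}}^!$ induces through the pushouts a functor $F^{⏚}\colon\mathbf C^{⏚}\to\mathbf D^{⏚}$. **Theorem.** Let $\mathbf C$ and $\mathbf D$ be $\dagger$-SMCs and let $F\colon\mathbf C\to\mathbf D$ be a $\dagger$-SMC-functor. If $F$ is faithful and $F_{\mathrm{iso}}\colon\mathbf C_{\mathrm{iso}}\to\mathbf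 D_{\mathrm{iso}}$ is surjective, then $F^{⏚}\colon\mathbf C^{⏚}\to\mathbf D^{⏚}$ is faithful. If furthermore $F$ is surjective, then $F^{⏚}$ is surjective and faithful. -/

import Mathlib

open CategoryTheory MonoidalCategory

universe w v v' u u'

/-! ### Strict dagger symmetric monoidal categories and their functors -/

/-- A monoidal category is strict: the tensor is associative and unital on the nose, and the
structural isomorphisms are identities (transported along these equalities of objects). -/
class StrictMonoidal (C : Type u) [Category.{v} C] [MonoidalCategory C] : Prop where
  tensor_assoc : ∀ X Y Z : C, (X ⊗ Y) ⊗ Z = X ⊗ (Y ⊗ Z)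
  unit_tensor : ∀ X : C, 𝟙_ C ⊗ X = X
  tensor_unit : ∀ X : C, X ⊗ 𝟙_ C = X
  associator_hom : ∀ X Y Z : C, (α_ X Y Z).hom = eqToHom (tensor_assoc X Y Z)
  leftUnitor_hom : ∀ X : C, (λ_ X).hom = eqToHom (unit_tensor X)
  rightUnitor_hom : ∀ X : C, (ρ_ X).hom = eqToHom (tensor_unit X)

/-- A monoidal functor is strict: it preserves unit and tensor on the nose, with identities as
comparison maps. -/
class StrictMonoidalFunctor {C : Type u} [Category.{v} C] [MonoidalCategory C]
    {D : Type u'} [Category.{v'} D] [MonoidalCategory D] (F : C ⥤ D) [F.Monoidal] : Prop where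
  unit_obj : 𝟙_ D = F.obj (𝟙_ C)
  tensor_obj : ∀ X Y : C, F.obj X ⊗ F.obj Y = F.obj (X ⊗ Y)
  ε_eq : Functor.LaxMonoidal.ε F = eqToHom unit_obj
  μ_eq : ∀ X Y : C, Functor.LaxMonoidal.μ F X Y = eqToHom (tensor_obj X Y)

/-- A dagger on a symmetric monoidal category: an identity-on-objects, involutive, contravariant
symmetric monoidal functor. -/
class DaggerSymmetric (C : Type u) [Category.{v} C] [MonoidalCategory C]
    [SymmetricCategory C] where
  dag : ∀ {X Y : C}, (X ⟶ Y) → (Y ⟶ X)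
  dag_dag : ∀ {X Y : C} (f : X ⟶ Y), dag (dag f) = f
  dag_id : ∀ X : C, dag (𝟙 X) = 𝟙 X
  dag_comp : ∀ {X Y Z : C} (f : X ⟶ Y) (g : Y ⟶ Z), dag (f ≫ g) = dag g ≫ dag f
  dag_tensor : ∀ {X Y X' Y' : C} (f : X ⟶ Y) (g : X' ⟶ Y'), dag (f ⊗ₘ g) = dag f ⊗ₘ dag g
  dag_braiding : ∀ X Y : C, dag (β_ X Y).hom = (β_ Y X).hom

/-- A functor commutes with the daggers. -/
class DaggerFunctor {C : Type u} [Category.{v} C] [MonoidalCategory C] [SymmetricCategory C]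
    [DaggerSymmetric C] {D : Type u'} [Category.{v'} D] [MonoidalCategory D] [SymmetricCategory D]
    [DaggerSymmetric D] (F : C ⥤ D) : Prop where
  map_dag : ∀ {X Y : C} (f : X ⟶ Y), F.map (DaggerSymmetric.dag f) = DaggerSymmetric.dag (F.map f)

/-- A functor is surjective: every object of the target is an image, and all the maps between
hom-sets are surjective. -/
def SurjectiveFunctor {C : Type u} [Category.{v} C] {D : Type u'} [Category.{v'} D]
    (F : C ⥤ D) : Prop :=
  Function.Surjective F.obj ∧ F.Full

/-! ### The subcategory of isometries -/

/-- `f` is an isometry: `f† ∘ f = 1`. -/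
def isometries (C : Type u) [Category.{v} C] [MonoidalCategory C] [SymmetricCategory C]
    [DaggerSymmetric C] : MorphismProperty C :=
  fun X _ f => f ≫ DaggerSymmetric.dag f = 𝟙 X

section Isometries

variable {C : Type u} [Category.{v} C] [MonoidalCategory C] [SymmetricCategory C]
  [DaggerSymmetric C]

theorem isometries_id (X : C) : isometries C (𝟙 X) := by
  simp [isometries, DaggerSymmetric.dag_id]

theorem isometries_comp {X Y Z : C} (f : X ⟶ Y) (g : Y ⟶ Z) (hf : isometries C f)
    (hg : isometries C g) : isometries C (f ≫ g) := by
  unfold isometries at *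
  rw [DaggerSymmetric.dag_comp, Category.assoc, ← Category.assoc g, hg, Category.id_comp, hf]

theorem isometries_tensor {X Y X' Y' : C} (f : X ⟶ Y) (g : X' ⟶ Y') (hf : isometries C f)
    (hg : isometries C g) : isometries C (f ⊗ₘ g) := by
  unfold isometries at *
  rw [DaggerSymmetric.dag_tensor, tensorHom_comp_tensorHom, hf, hg, id_tensorHom_id]

theorem isometries_eqToHom {X Y : C} (h : X = Y) : isometries C (eqToHom h) := by
  subst h
  exact isometries_id X

theorem isometries_inv_of_eqToHom {X Y : C} (e : X ≅ Y) (h : X = Y) (he : e.hom = eqToHom h) :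
    isometries C e.inv := by
  have : e.inv = eqToHom h.symm := by
    rw [← cancel_epi e.hom, e.hom_inv_id, he, eqToHom_trans, eqToHom_refl]
  rw [this]
  exact isometries_eqToHom h.symm

end Isometries

section IsometryInstances

variable (C : Type u) [Category.{v} C] [MonoidalCategory C] [SymmetricCategory C]
  [StrictMonoidal C] [DaggerSymmetric C]

instance isometries_isStableUnderBraiding : (isometries C).IsStableUnderBraiding where
  id_mem X := isometries_id X
  comp_mem f g hf hg := isometries_comp f g hf hg
  whiskerLeft X _ _ g hg := by
    rw [← id_tensorHom]
    exact isometries_tensor _ _ (isometries_id X) hg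
  whiskerRight f hf Y := by
    rw [← tensorHom_id]
    exact isometries_tensor _ _ hf (isometries_id Y)
  associator_hom_mem X Y Z := by
    rw [StrictMonoidal.associator_hom]
    exact isometries_eqToHom _
  associator_inv_mem X Y Z := isometries_inv_of_eqToHom _ _ (StrictMonoidal.associator_hom X Y Z)
  leftUnitor_hom_mem X := by
    rw [StrictMonoidal.leftUnitor_hom]
    exact isometries_eqToHom _
  leftUnitor_inv_mem X := isometries_inv_of_eqToHom _ _ (StrictMonoidal.leftUnitor_hom X)
  rightUnitor_hom_mem X := by
    rw [StrictMonoidal.rightUnitor_hom]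
    exact isometries_eqToHom _
  rightUnitor_inv_mem X := isometries_inv_of_eqToHom _ _ (StrictMonoidal.rightUnitor_hom X)
  braiding_hom_mem X Y := by
    unfold isometries
    rw [DaggerSymmetric.dag_braiding, SymmetricCategory.symmetry]
  braiding_inv_mem X Y := by
    unfold isometries
    rw [← SymmetricCategory.braiding_swap_eq_inv_braiding, DaggerSymmetric.dag_braiding,
      SymmetricCategory.symmetry]

/-- The symmetric monoidal category of isometries of `C`: same objects as `C`, and the isometries
as morphisms. -/
abbrev IsometryCat : Type u := WideSubcategory (isometries C)

end IsometryInstances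

section IsometryFunctor

variable {C : Type u} [Category.{v} C] [MonoidalCategory C] [SymmetricCategory C]
  [StrictMonoidal C] [DaggerSymmetric C]
  {D : Type u'} [Category.{v'} D] [MonoidalCategory D] [SymmetricCategory D]
  [StrictMonoidal D] [DaggerSymmetric D]

/-- The restriction of a dagger symmetric monoidal functor to the isometries. -/
def isoFunctor (F : C ⥤ D) [DaggerFunctor F] : IsometryCat C ⥤ IsometryCat D where
  obj X := ⟨F.obj X.obj⟩
  map f := ⟨F.map f.hom, by
    have h : f.hom ≫ DaggerSymmetric.dag f.hom = 𝟙 _ := f.property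
    have h' := congrArg F.map h
    rw [F.map_comp, DaggerFunctor.map_dag, F.map_id] at h'
    exact h'⟩
  map_id X := by ext; exact F.map_id _
  map_comp f g := by ext; exact F.map_comp _ _

instance isoFunctorBraided (F : C ⥤ D) [F.Braided] [StrictMonoidalFunctor F] [DaggerFunctor F] :
    (isoFunctor F).Braided where
  toMonoidal := Functor.CoreMonoidal.toMonoidal
    { εIso := WideSubcategory.isoMk (Functor.Monoidal.εIso F)
        (by
          rw [Functor.Monoidal.εIso_hom, StrictMonoidalFunctor.ε_eq]
          exact isometries_eqToHom _)
        (isometries_inv_of_eqToHom _ _ StrictMonoidalFunctor.ε_eq)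
      μIso := fun X Y => WideSubcategory.isoMk (Functor.Monoidal.μIso F X.obj Y.obj)
        (by
          rw [Functor.Monoidal.μIso_hom, StrictMonoidalFunctor.μ_eq]
          exact isometries_eqToHom _)
        (isometries_inv_of_eqToHom _ _ (StrictMonoidalFunctor.μ_eq X.obj Y.obj))
      μIso_hom_natural_left := fun f X => by
        ext
        exact Functor.LaxMonoidal.μ_natural_left F f.hom X.obj
      μIso_hom_natural_right := fun X f => by
        ext
        exact Functor.LaxMonoidal.μ_natural_right F X.obj f.hom
      associativity := fun X Y Z => by
        ext
        exact Functor.LaxMonoidal.associativity F X.obj Y.obj Z.obj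
      left_unitality := fun X => by
        ext
        exact Functor.LaxMonoidal.left_unitality F X.obj
      right_unitality := fun X => by
        ext
        exact Functor.LaxMonoidal.right_unitality F X.obj }
  braided X Y := by
    ext
    exact Functor.LaxBraided.braided X.obj Y.obj

end IsometryFunctor

/-! ### Adding generators and equations to a symmetric monoidal category

Both steps of the discard construction add morphisms to a symmetric monoidal category without
changing its objects: the new morphisms are classes of formal composites and tensors. -/

/-- Formal composites and tensors of morphisms of `E` and of generators from `G`. -/
inductive Term (E : Type u) [Category.{v} E] [MonoidalCategory E] (G : E → E → Type w) :
    E → E → Type (max u v w)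
  | of {X Y : E} (f : X ⟶ Y) : Term E G X Y
  | gen {X Y : E} (g : G X Y) : Term E G X Y
  | comp {X Y Z : E} (s : Term E G X Y) (t : Term E G Y Z) : Term E G X Z
  | tensor {X Y X' Y' : E} (s : Term E G X Y) (t : Term E G X' Y') : Term E G (X ⊗ X') (Y ⊗ Y')

/-- The equality of formal terms generated by the equations `R`, the equations that hold in `E`,
and the axioms of symmetric monoidal categories. -/
inductive TermRel {E : Type u} [Category.{v} E] [MonoidalCategory E] [SymmetricCategory E]
    {G : E → E → Type w} (R : ∀ ⦃X Y : E⦄, Term E G X Y → Term E G X Y → Prop) :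
    ∀ {X Y : E}, Term E G X Y → Term E G X Y → Prop
  | rel {X Y : E} {s t : Term E G X Y} (h : R s t) : TermRel R s t
  | refl {X Y : E} (s : Term E G X Y) : TermRel R s s
  | symm {X Y : E} {s t : Term E G X Y} (h : TermRel R s t) : TermRel R t s
  | trans {X Y : E} {r s t : Term E G X Y} (h : TermRel R r s) (h' : TermRel R s t) :
      TermRel R r t
  | comp_congr {X Y Z : E} {s s' : Term E G X Y} {t t' : Term E G Y Z}
      (h : TermRel R s s') (h' : TermRel R t t') : TermRel R (s.comp t) (s'.comp t')
  | tensor_congr {X Y X' Y' : E} {s s' : Term E G X Y} {t t' : Term E G X' Y'}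
      (h : TermRel R s s') (h' : TermRel R t t') : TermRel R (s.tensor t) (s'.tensor t')
  | of_comp {X Y Z : E} (f : X ⟶ Y) (g : Y ⟶ Z) :
      TermRel R (.of (f ≫ g)) ((Term.of f).comp (.of g))
  | of_tensor {X Y X' Y' : E} (f : X ⟶ Y) (g : X' ⟶ Y') :
      TermRel R (.of (f ⊗ₘ g)) ((Term.of f).tensor (.of g))
  | id_comp {X Y : E} (s : Term E G X Y) : TermRel R ((Term.of (𝟙 X)).comp s) s
  | comp_id {X Y : E} (s : Term E G X Y) : TermRel R (s.comp (.of (𝟙 Y))) s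
  | assoc {X Y Z W : E} (r : Term E G X Y) (s : Term E G Y Z) (t : Term E G Z W) :
      TermRel R ((r.comp s).comp t) (r.comp (s.comp t))
  | interchange {X Y Z X' Y' Z' : E} (s : Term E G X Y) (s' : Term E G X' Y')
      (t : Term E G Y Z) (t' : Term E G Y' Z') :
      TermRel R ((s.tensor s').comp (t.tensor t')) ((s.comp t).tensor (s'.comp t'))
  | associator_naturality {X Y X' Y' X'' Y'' : E} (r : Term E G X Y) (s : Term E G X' Y')
      (t : Term E G X'' Y'') :
      TermRel R (((r.tensor s).tensor t).comp (.of (α_ Y Y' Y'').hom))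
        ((Term.of (α_ X X' X'').hom).comp (r.tensor (s.tensor t)))
  | leftUnitor_naturality {X Y : E} (s : Term E G X Y) :
      TermRel R (((Term.of (𝟙 (𝟙_ E))).tensor s).comp (.of (λ_ Y).hom))
        ((Term.of (λ_ X).hom).comp s)
  | rightUnitor_naturality {X Y : E} (s : Term E G X Y) :
      TermRel R ((s.tensor (.of (𝟙 (𝟙_ E)))).comp (.of (ρ_ Y).hom))
        ((Term.of (ρ_ X).hom).comp s)
  | braiding_naturality {X Y X' Y' : E} (s : Term E G X Y) (t : Term E G X' Y') :
      TermRel R ((s.tensor t).comp (.of (β_ Y Y').hom))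
        ((Term.of (β_ X X').hom).comp (t.tensor s))

/-- Objects of the symmetric monoidal category obtained from `E` by adding the generators `G` and
the equations `R`: they are the objects of `E`. -/
structure Extension {E : Type u} [Category.{v} E] [MonoidalCategory E] [SymmetricCategory E]
    {G : E → E → Type w} (R : ∀ ⦃X Y : E⦄, Term E G X Y → Term E G X Y → Prop) : Type u where
  as : E

namespace Extension

variable {E : Type u} [Category.{v} E] [MonoidalCategory E] [SymmetricCategory E]
  {G : E → E → Type w} (R : ∀ ⦃X Y : E⦄, Term E G X Y → Term E G X Y → Prop)

/-- Equality of terms as a setoid. -/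
def setoid (X Y : E) : Setoid (Term E G X Y) where
  r := TermRel R
  iseqv := ⟨TermRel.refl, TermRel.symm, TermRel.trans⟩

instance : Category.{max u v w} (Extension R) where
  Hom X Y := Quotient (setoid R X.as Y.as)
  id X := Quotient.mk _ (.of (𝟙 X.as))
  comp f g := Quotient.map₂ Term.comp (fun _ _ h _ _ h' => TermRel.comp_congr h h') f g
  id_comp := by rintro X Y ⟨s⟩; exact Quotient.sound (TermRel.id_comp s)
  comp_id := by rintro X Y ⟨s⟩; exact Quotient.sound (TermRel.comp_id s)
  assoc := by rintro X Y Z W ⟨r⟩ ⟨s⟩ ⟨t⟩; exact Quotient.sound (TermRel.assoc r s t)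

/-- The morphism represented by a term. -/
def hom {X Y : E} (s : Term E G X Y) : (⟨X⟩ : Extension R) ⟶ ⟨Y⟩ := Quotient.mk (setoid R X Y) s

/-- The inclusion of `E`. -/
def incl : E ⥤ Extension R where
  obj X := ⟨X⟩
  map f := hom R (.of f)
  map_id _ := rfl
  map_comp f g := Quotient.sound (TermRel.of_comp f g)

instance : MonoidalCategoryStruct (Extension R) where
  tensorObj X Y := ⟨X.as ⊗ Y.as⟩
  tensorUnit := ⟨𝟙_ E⟩
  tensorHom f g := Quotient.map₂ Term.tensor (fun _ _ h _ _ h' => TermRel.tensor_congr h h') f g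
  whiskerLeft X _ _ g := Quotient.map₂ Term.tensor
    (fun _ _ h _ _ h' => TermRel.tensor_congr h h') (𝟙 X : X ⟶ X) g
  whiskerRight f Y := Quotient.map₂ Term.tensor
    (fun _ _ h _ _ h' => TermRel.tensor_congr h h') f (𝟙 Y : Y ⟶ Y)
  associator X Y Z := (incl R).mapIso (α_ X.as Y.as Z.as)
  leftUnitor X := (incl R).mapIso (λ_ X.as)
  rightUnitor X := (incl R).mapIso (ρ_ X.as)

theorem incl_map_tensor {X Y X' Y' : E} (f : X ⟶ Y) (g : X' ⟶ Y') :
    (incl R).map (f ⊗ₘ g) = (incl R).map f ⊗ₘ (incl R).map g :=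
  Quotient.sound (TermRel.of_tensor f g)

instance : MonoidalCategory (Extension R) :=
  MonoidalCategory.ofTensorHom
    (id_tensorHom_id := fun X Y => by
      have h := incl_map_tensor R (𝟙 X.as) (𝟙 Y.as)
      rw [id_tensorHom_id] at h
      exact h.symm)
    (id_tensorHom := fun _ _ _ _ => rfl)
    (tensorHom_id := fun _ _ => rfl)
    (tensorHom_comp_tensorHom := by
      rintro X Y Z X' Y' Z' ⟨s⟩ ⟨s'⟩ ⟨t⟩ ⟨t'⟩
      exact Quotient.sound (TermRel.interchange s s' t t'))
    (associator_naturality := by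
      rintro _ _ _ _ _ _ ⟨r⟩ ⟨s⟩ ⟨t⟩
      exact Quotient.sound (TermRel.associator_naturality r s t))
    (leftUnitor_naturality := by
      rintro _ _ ⟨s⟩
      exact Quotient.sound (TermRel.leftUnitor_naturality s))
    (rightUnitor_naturality := by
      rintro _ _ ⟨s⟩
      exact Quotient.sound (TermRel.rightUnitor_naturality s))
    (pentagon := fun W X Y Z => by
      have h := congrArg (incl R).map (MonoidalCategory.pentagon W.as X.as Y.as Z.as)
      rw [← id_tensorHom, ← tensorHom_id] at h
      simp only [Functor.map_comp, incl_map_tensor] at h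
      exact h)
    (triangle := fun X Y => by
      have h := congrArg (incl R).map (MonoidalCategory.triangle X.as Y.as)
      rw [← id_tensorHom, ← tensorHom_id] at h
      simp only [Functor.map_comp, incl_map_tensor] at h
      exact h)

instance : SymmetricCategory (Extension R) where
  braiding X Y := (incl R).mapIso (β_ X.as Y.as)
  braiding_naturality_right X _ _ g := by
    obtain ⟨s⟩ := g
    exact Quotient.sound (TermRel.braiding_naturality (.of (𝟙 X.as)) s)
  braiding_naturality_left f Z := by
    obtain ⟨s⟩ := f
    exact Quotient.sound (TermRel.braiding_naturality s (.of (𝟙 Z.as)))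
  hexagon_forward X Y Z := by
    have h := congrArg (incl R).map (BraidedCategory.hexagon_forward X.as Y.as Z.as)
    rw [← id_tensorHom, ← tensorHom_id] at h
    simp only [Functor.map_comp, incl_map_tensor] at h
    rw [← id_tensorHom, ← tensorHom_id]
    exact h
  hexagon_reverse X Y Z := by
    have h := congrArg (incl R).map (BraidedCategory.hexagon_reverse X.as Y.as Z.as)
    rw [← id_tensorHom, ← tensorHom_id] at h
    simp only [Functor.map_comp, incl_map_tensor] at h
    rw [← id_tensorHom, ← tensorHom_id]
    exact h
  symmetry X Y := by
    have h := congrArg (incl R).map (SymmetricCategory.symmetry X.as Y.as)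
    simp only [Functor.map_comp] at h
    exact h

theorem incl_map_whiskerRight {X Y : E} (f : X ⟶ Y) (Z : E) :
    (incl R).map (f ▷ Z) = (incl R).map f ▷ (incl R).obj Z :=
  (congrArg (incl R).map (tensorHom_id f Z).symm).trans
    (Quotient.sound (TermRel.of_tensor f (𝟙 Z)))

theorem incl_map_whiskerLeft (Z : E) {X Y : E} (f : X ⟶ Y) :
    (incl R).map (Z ◁ f) = (incl R).obj Z ◁ (incl R).map f :=
  (congrArg (incl R).map (id_tensorHom Z f).symm).trans
    (Quotient.sound (TermRel.of_tensor (𝟙 Z) f))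

theorem comp_aux {T : Type u'} [Category.{v'} T] {X Y : T} (p : X ⟶ X) (a : X ⟶ Y) (q : Y ⟶ Y)
    (hp : p = 𝟙 X) (hq : q = 𝟙 Y) : p ≫ 𝟙 X ≫ a = a ≫ q ≫ 𝟙 Y := by
  simp [hp, hq]

theorem comp_aux' {T : Type u'} [Category.{v'} T] {X Y : T} (p : X ⟶ X) (a : X ⟶ Y)
    (hp : p = 𝟙 X) : a = p ≫ 𝟙 X ≫ a := by
  simp [hp]

/-- The inclusion of `E` is a symmetric monoidal functor, with identities as comparison maps. -/
instance : (incl R).Braided where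
  toMonoidal := Functor.CoreMonoidal.toMonoidal
    { εIso := Iso.refl (𝟙_ (Extension R))
      μIso := fun X Y => Iso.refl ((incl R).obj X ⊗ (incl R).obj Y)
      μIso_hom_natural_left := fun f X => (Category.comp_id _).trans
        ((incl_map_whiskerRight R f X).symm.trans (Category.id_comp _).symm)
      μIso_hom_natural_right := fun X f => (Category.comp_id _).trans
        ((incl_map_whiskerLeft R X f).symm.trans (Category.id_comp _).symm)
      associativity := fun X Y Z =>
        comp_aux _ ((incl R).map (α_ X Y Z).hom) _ (id_whiskerRight _ _) (whiskerLeft_id _ _)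
      left_unitality := fun X =>
        comp_aux' _ ((incl R).map (λ_ X).hom) (id_whiskerRight _ _)
      right_unitality := fun X =>
        comp_aux' _ ((incl R).map (ρ_ X).hom) (whiskerLeft_id _ _) }
  braided _ _ := (Category.id_comp _).trans (Category.comp_id _).symm

/-- If `E` is strict, then so is the extension. -/
instance [StrictMonoidal E] : StrictMonoidal (Extension R) where
  tensor_assoc X Y Z :=
    congrArg (incl R).obj (StrictMonoidal.tensor_assoc X.as Y.as Z.as)
  unit_tensor X := congrArg (incl R).obj (StrictMonoidal.unit_tensor X.as)
  tensor_unit X := congrArg (incl R).obj (StrictMonoidal.tensor_unit X.as)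
  associator_hom X Y Z :=
    (congrArg (incl R).map (StrictMonoidal.associator_hom X.as Y.as Z.as)).trans
      (eqToHom_map (incl R) _)
  leftUnitor_hom X :=
    (congrArg (incl R).map (StrictMonoidal.leftUnitor_hom X.as)).trans (eqToHom_map (incl R) _)
  rightUnitor_hom X :=
    (congrArg (incl R).map (StrictMonoidal.rightUnitor_hom X.as)).trans (eqToHom_map (incl R) _)

section Lift

open Functor.LaxMonoidal Functor.OplaxMonoidal

variable {R}
variable {T : Type u'} [Category.{v'} T] [MonoidalCategory T] [SymmetricCategory T]
  (Φ : E ⥤ T) [Φ.Braided] (γ : ∀ {X Y : E}, G X Y → (Φ.obj X ⟶ Φ.obj Y))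

/-- The interpretation of formal terms in `T`, given by a symmetric monoidal functor on `E` and an
interpretation of the generators. -/
def interp : ∀ {X Y : E}, Term E G X Y → (Φ.obj X ⟶ Φ.obj Y)
  | _, _, .of f => Φ.map f
  | _, _, .gen g => γ g
  | _, _, .comp s t => interp s ≫ interp t
  | _, _, .tensor s t => δ Φ _ _ ≫ (interp s ⊗ₘ interp t) ≫ μ Φ _ _

theorem associator_aux {X Y X' Y' X'' Y'' : E} (r : Φ.obj X ⟶ Φ.obj Y)
    (s : Φ.obj X' ⟶ Φ.obj Y') (t : Φ.obj X'' ⟶ Φ.obj Y'') :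
    (δ Φ _ _ ≫ ((δ Φ _ _ ≫ (r ⊗ₘ s) ≫ μ Φ _ _) ⊗ₘ t) ≫ μ Φ _ _) ≫ Φ.map (α_ Y Y' Y'').hom =
      Φ.map (α_ X X' X'').hom ≫ δ Φ _ _ ≫ (r ⊗ₘ (δ Φ _ _ ≫ (s ⊗ₘ t) ≫ μ Φ _ _)) ≫ μ Φ _ _ := by
  have h1 : (δ Φ X X' ≫ (r ⊗ₘ s) ≫ μ Φ Y Y') ⊗ₘ t =
      δ Φ X X' ▷ Φ.obj X'' ≫ ((r ⊗ₘ s) ⊗ₘ t) ≫ μ Φ Y Y' ▷ Φ.obj Y'' := by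
    simp only [← tensorHom_id, tensorHom_comp_tensorHom, Category.id_comp, Category.comp_id]
  have h2 : r ⊗ₘ (δ Φ X' X'' ≫ (s ⊗ₘ t) ≫ μ Φ Y' Y'') =
      Φ.obj X ◁ δ Φ X' X'' ≫ (r ⊗ₘ (s ⊗ₘ t)) ≫ Φ.obj Y ◁ μ Φ Y' Y'' := by
    simp only [← id_tensorHom, tensorHom_comp_tensorHom, Category.id_comp, Category.comp_id]
  rw [h1, h2, Functor.Monoidal.map_associator, Functor.Monoidal.map_associator]
  simp

theorem leftUnitor_aux {X Y : E} (s : Φ.obj X ⟶ Φ.obj Y) :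
    (δ Φ _ _ ≫ (Φ.map (𝟙 (𝟙_ E)) ⊗ₘ s) ≫ μ Φ _ _) ≫ Φ.map (λ_ Y).hom =
      Φ.map (λ_ X).hom ≫ s := by
  rw [Functor.Monoidal.map_leftUnitor, Functor.Monoidal.map_leftUnitor, CategoryTheory.Functor.map_id,
    id_tensorHom]
  simp only [Category.assoc, Functor.Monoidal.μ_δ_assoc, whisker_exchange_assoc,
    leftUnitor_naturality]

theorem rightUnitor_aux {X Y : E} (s : Φ.obj X ⟶ Φ.obj Y) :
    (δ Φ _ _ ≫ (s ⊗ₘ Φ.map (𝟙 (𝟙_ E))) ≫ μ Φ _ _) ≫ Φ.map (ρ_ Y).hom =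
      Φ.map (ρ_ X).hom ≫ s := by
  rw [Functor.Monoidal.map_rightUnitor, Functor.Monoidal.map_rightUnitor, CategoryTheory.Functor.map_id,
    tensorHom_id]
  simp only [Category.assoc, Functor.Monoidal.μ_δ_assoc, ← whisker_exchange_assoc,
    rightUnitor_naturality]

theorem interp_eq_of_termRel
    (hR : ∀ {X Y : E} {s t : Term E G X Y}, R s t → interp Φ γ s = interp Φ γ t)
    {X Y : E} {s t : Term E G X Y} (h : TermRel R s t) : interp Φ γ s = interp Φ γ t := by
  induction h with
  | rel h => exact hR h
  | refl s => rfl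
  | symm _ ih => exact ih.symm
  | trans _ _ ih ih' => exact ih.trans ih'
  | comp_congr _ _ ih ih' => simp only [interp, ih, ih']
  | tensor_congr _ _ ih ih' => simp only [interp, ih, ih']
  | of_comp f g => simp [interp]
  | of_tensor f g => simp [interp]
  | id_comp s => simp [interp]
  | comp_id s => simp [interp]
  | assoc r s t => simp [interp]
  | interchange s s' t t' => simp [interp]
  | associator_naturality r s t => exact associator_aux Φ _ _ _
  | leftUnitor_naturality s => exact leftUnitor_aux Φ _
  | rightUnitor_naturality s => exact rightUnitor_aux Φ _
  | braiding_naturality s t => simp [interp]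

/-- The functor out of the extension induced by a symmetric monoidal functor on `E` and an
interpretation of the generators that satisfies the equations. -/
def lift (hR : ∀ {X Y : E} {s t : Term E G X Y}, R s t → interp Φ γ s = interp Φ γ t) :
    Extension R ⥤ T where
  obj X := Φ.obj X.as
  map f := Quotient.lift (interp Φ γ) (fun _ _ h => interp_eq_of_termRel Φ γ hR h) f
  map_id X := Φ.map_id X.as
  map_comp := by rintro X Y Z ⟨s⟩ ⟨t⟩; rfl

variable (hR : ∀ {X Y : E} {s t : Term E G X Y}, R s t → interp Φ γ s = interp Φ γ t)

theorem lift_map_tensor {X Y X' Y' : Extension R} (f : X ⟶ Y) (g : X' ⟶ Y') :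
    (lift Φ γ hR).map (f ⊗ₘ g) =
      δ Φ X.as X'.as ≫ ((lift Φ γ hR).map f ⊗ₘ (lift Φ γ hR).map g) ≫ μ Φ Y.as Y'.as := by
  obtain ⟨s⟩ := f
  obtain ⟨t⟩ := g
  rfl

end Lift

end Extension

/-! ### The affine completion -/

/-- One generator `A ⟶ I` for each object `A`. -/
inductive AffineGen (E : Type u) [Category.{v} E] [MonoidalCategory E] : E → E → Type u
  | discard (A : E) : AffineGen E A (𝟙_ E)

/-- The equations of the affine completion: every morphism to the unit is the discard generator,
that is, the unit is terminal. -/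
inductive AffineRel (E : Type u) [Category.{v} E] [MonoidalCategory E] :
    ∀ ⦃X Y : E⦄, Term E (AffineGen E) X Y → Term E (AffineGen E) X Y → Prop
  | terminal {A : E} (t : Term E (AffineGen E) A (𝟙_ E)) : AffineRel E t (.gen (.discard A))

/-- The affine completion `E^!` of a symmetric monoidal category `E`: the same objects, and a
freely added morphism `!_A : A ⟶ I` for each object `A`, subject to the unit `I` being terminal. -/
abbrev Affine (E : Type u) [Category.{v} E] [MonoidalCategory E] [SymmetricCategory E] : Type u :=
  Extension (AffineRel E)

namespace Affine

variable (E : Type u) [Category.{v} E] [MonoidalCategory E] [SymmetricCategory E]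

/-- The canonical functor from `E` to its affine completion. -/
abbrev incl : E ⥤ Affine E := Extension.incl (AffineRel E)

variable {E}

/-- The added morphism `!_A`. -/
def discard (A : E) : (⟨A⟩ : Affine E) ⟶ 𝟙_ (Affine E) :=
  Extension.hom (AffineRel E) (.gen (.discard A))

theorem eq_discard {A : E} (f : (⟨A⟩ : Affine E) ⟶ 𝟙_ (Affine E)) : f = discard A := by
  obtain ⟨s⟩ := f
  exact Quotient.sound (TermRel.rel (AffineRel.terminal s))

theorem hom_unit_ext {X : Affine E} (f g : X ⟶ 𝟙_ (Affine E)) : f = g :=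
  (eq_discard f).trans (eq_discard g).symm

variable {E' : Type u'} [Category.{v'} E'] [MonoidalCategory E'] [SymmetricCategory E']

/-- The image of the added morphisms under `F^!`. -/
def mapGen (F : E ⥤ E') [F.Braided] :
    ∀ {X Y : E}, AffineGen E X Y → ((F ⋙ incl E').obj X ⟶ (F ⋙ incl E').obj Y)
  | _, _, .discard A => discard (F.obj A) ≫ (incl E').map (Functor.LaxMonoidal.ε F)

theorem interp_eq (F : E ⥤ E') [F.Braided] {X Y : E} {s t : Term E (AffineGen E) X Y}
    (h : AffineRel E s t) : Extension.interp (F ⋙ incl E') (mapGen F) s =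
      Extension.interp (F ⋙ incl E') (mapGen F) t := by
  obtain ⟨t⟩ := h
  rw [← cancel_mono ((incl E').map (Functor.OplaxMonoidal.η F))]
  exact hom_unit_ext _ _

/-- The functor `F^! : E^! ⥤ E'^!` induced by a symmetric monoidal functor `F`: it sends `!_A` to
`!_{F A}` and agrees with `F` on the morphisms of `E`. -/
def map (F : E ⥤ E') [F.Braided] : Affine E ⥤ Affine E' :=
  Extension.lift (F ⋙ incl E') (mapGen F) (interp_eq F)

end Affine

/-! ### The discard construction -/

section Discard

variable (C : Type u) [Category.{v} C] [MonoidalCategory C] [SymmetricCategory C]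
  [StrictMonoidal C] [DaggerSymmetric C]

/-- The generators: all the morphisms of the affine completion of the category of isometries. -/
abbrev DiscardGen (X Y : C) : Type (max u v) :=
  (⟨⟨X⟩⟩ : Affine (IsometryCat C)) ⟶ (⟨⟨Y⟩⟩ : Affine (IsometryCat C))

/-- The equations of the pushout of `C` and `(C_iso)^!` over `C_iso`: the morphisms of `(C_iso)^!`
compose and tensor as they do there, and the two images of each isometry are identified. -/
inductive DiscardRel :
    ∀ ⦃X Y : C⦄, Term C (DiscardGen C) X Y → Term C (DiscardGen C) X Y → Prop
  | comp {X Y Z : C} (f : DiscardGen C X Y) (g : DiscardGen C Y Z) :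
      DiscardRel (.gen (f ≫ g)) ((Term.gen f).comp (.gen g))
  | tensor {X Y X' Y' : C} (f : DiscardGen C X Y) (g : DiscardGen C X' Y') :
      DiscardRel (.gen (X := X ⊗ X') (Y := Y ⊗ Y') (f ⊗ₘ g)) ((Term.gen f).tensor (.gen g))
  | glue {X Y : IsometryCat C} (f : X ⟶ Y) :
      DiscardRel (.gen ((Affine.incl (IsometryCat C)).map f)) (.of f.hom)

/-- The discard construction `C^⏚`: the pushout, with the same objects, of the inclusion
`C_iso ⥤ C` and of `C_iso ⥤ (C_iso)^!`. Its morphisms are the formal composites and tensors of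
morphisms of `C` and of `(C_iso)^!`, modulo the equations of both categories, the axioms of
symmetric monoidal categories, and the identification of the two images of `C_iso`. -/
abbrev Discard : Type u := Extension (DiscardRel C)

namespace Discard

/-- The functor `C ⥤ C^⏚`. -/
abbrev incl : C ⥤ Discard C := Extension.incl (DiscardRel C)

/-- The functor `(C_iso)^! ⥤ C^⏚`. -/
def inclAffine : Affine (IsometryCat C) ⥤ Discard C where
  obj X := ⟨X.as.obj⟩
  map f := Extension.hom (DiscardRel C) (.gen f)
  map_id X := Quotient.sound (TermRel.rel (DiscardRel.glue (𝟙 X.as)))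
  map_comp f g := Quotient.sound (TermRel.rel (DiscardRel.comp f g))

/-- The defining square of `C^⏚` commutes. -/
theorem square : wideSubcategoryInclusion (isometries C) ⋙ incl C =
    Affine.incl (IsometryCat C) ⋙ inclAffine C :=
  CategoryTheory.Functor.hext (fun _ => rfl) (fun _ _ f =>
    heq_of_eq (Quotient.sound (TermRel.rel (DiscardRel.glue f))).symm)

theorem inclAffine_map_tensor {X Y X' Y' : Affine (IsometryCat C)} (f : X ⟶ Y) (g : X' ⟶ Y') :
    (inclAffine C).map (f ⊗ₘ g) = (inclAffine C).map f ⊗ₘ (inclAffine C).map g :=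
  Quotient.sound (TermRel.rel (DiscardRel.tensor f g))

variable {C}
variable {D : Type u'} [Category.{v'} D] [MonoidalCategory D] [SymmetricCategory D]
  [StrictMonoidal D] [DaggerSymmetric D]

/-- The image of the morphisms of `(C_iso)^!` under `F^⏚`, namely their image under `(F_iso)^!`. -/
def mapGen (F : C ⥤ D) [F.Braided] [StrictMonoidalFunctor F] [DaggerFunctor F] {X Y : C}
    (f : DiscardGen C X Y) : (F ⋙ incl D).obj X ⟶ (F ⋙ incl D).obj Y :=
  (inclAffine D).map ((Affine.map (isoFunctor F)).map f)

theorem inclAffine_map_δ (F : C ⥤ D) [F.Braided] [StrictMonoidalFunctor F] [DaggerFunctor F]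
    (X Y : C) :
    (inclAffine D).map
        (Functor.OplaxMonoidal.δ (isoFunctor F ⋙ Affine.incl (IsometryCat D)) ⟨X⟩ ⟨Y⟩) =
      Functor.OplaxMonoidal.δ (F ⋙ incl D) X Y := by
  rw [Functor.OplaxMonoidal.comp_δ, Functor.OplaxMonoidal.comp_δ]
  refine ((inclAffine D).map_comp _ _).trans ?_
  exact congr (congrArg _ (Quotient.sound (TermRel.rel (DiscardRel.glue
    (Functor.OplaxMonoidal.δ (isoFunctor F) ⟨X⟩ ⟨Y⟩))))) ((inclAffine D).map_id _)

theorem inclAffine_map_μ (F : C ⥤ D) [F.Braided] [StrictMonoidalFunctor F] [DaggerFunctor F]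
    (X Y : C) :
    (inclAffine D).map
        (Functor.LaxMonoidal.μ (isoFunctor F ⋙ Affine.incl (IsometryCat D)) ⟨X⟩ ⟨Y⟩) =
      Functor.LaxMonoidal.μ (F ⋙ incl D) X Y := by
  rw [Functor.LaxMonoidal.comp_μ, Functor.LaxMonoidal.comp_μ]
  refine ((inclAffine D).map_comp _ _).trans ?_
  exact congr (congrArg _ ((inclAffine D).map_id _)) (Quotient.sound (TermRel.rel (DiscardRel.glue
    (Functor.LaxMonoidal.μ (isoFunctor F) ⟨X⟩ ⟨Y⟩))))

theorem mapGen_tensor (F : C ⥤ D) [F.Braided] [StrictMonoidalFunctor F] [DaggerFunctor F]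
    {X Y X' Y' : C} (f : DiscardGen C X Y) (g : DiscardGen C X' Y') :
    mapGen F (X := X ⊗ X') (Y := Y ⊗ Y') (f ⊗ₘ g) =
      Functor.OplaxMonoidal.δ (F ⋙ incl D) X X' ≫ (mapGen F f ⊗ₘ mapGen F g) ≫
        Functor.LaxMonoidal.μ (F ⋙ incl D) Y Y' := by
  have h := Extension.lift_map_tensor (isoFunctor F ⋙ Affine.incl (IsometryCat D))
    (Affine.mapGen (isoFunctor F)) (Affine.interp_eq (isoFunctor F)) f g
  refine (congrArg (inclAffine D).map h).trans ?_
  refine ((inclAffine D).map_comp _ _).trans (congr (congrArg _ (inclAffine_map_δ F X X')) ?_)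
  refine ((inclAffine D).map_comp _ _).trans (congr (congrArg _ ?_) (inclAffine_map_μ F Y Y'))
  exact inclAffine_map_tensor D _ _

/-- The functor `F^⏚ : C^⏚ ⥤ D^⏚` induced by a dagger symmetric monoidal functor `F` through the
pushout: it agrees with `F` on the morphisms of `C` and with `(F_iso)^!` on those of `(C_iso)^!`. -/
def map (F : C ⥤ D) [F.Braided] [StrictMonoidalFunctor F] [DaggerFunctor F] :
    Discard C ⥤ Discard D :=
  Extension.lift (F ⋙ incl D) (mapGen F) (by
    rintro _ _ _ _ (⟨f, g⟩ | ⟨f, g⟩ | f)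
    · exact ((congrArg (inclAffine D).map ((Affine.map (isoFunctor F)).map_comp f g)).trans
        ((inclAffine D).map_comp _ _))
    · exact mapGen_tensor F f g
    · exact (Quotient.sound (TermRel.rel (DiscardRel.glue ((isoFunctor F).map f)))))

variable (F : C ⥤ D) [F.Braided] [StrictMonoidalFunctor F] [DaggerFunctor F]

/-- `F^⏚` extends `F`. -/
theorem incl_comp_map : incl C ⋙ map F = F ⋙ incl D := rfl

/-- `F^⏚` extends `(F_iso)^!`. -/
theorem inclAffine_comp_map :
    inclAffine C ⋙ map F = Affine.map (isoFunctor F) ⋙ inclAffine D := rfl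

end Discard

end Discard

/-! ### Morphisms with an environment -/

/-! Every morphism of the discard construction has a normal form: a morphism `f : A ⟶ B ⊗ X` of the
base with its environment `X` discarded (`exists_eq_traceOut`). The question is when two normal
forms agree. An isometry on the environment can always be absorbed by the discard
(`traceOut_comp_whiskerLeft`). For the converse, pairs `(X, f)` modulo the equivalence generated by
isometries of environments are made into a symmetric monoidal category `EnvCat`, which satisfies the
equations of the pushout. The resulting functor `toEnvCat` sends the normal form of `f` to the class
of `f` (`toEnvCat_map_traceOut`), so equal normal forms are joined by a zigzag of isometries.

Faithfulness is then a lifting problem. If the images of two normal forms agree, a zigzag in `D`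
joins their representatives, and it is lifted to `C` one edge at a time. Environments and isometries
lift because the restriction of `F` to isometries is surjective. An edge traversed in its own
direction only appends an isometry. Traversed backwards along `w`, it is lifted by appending `w†`:
the equation `w ≫ w† = 1` recovers the earlier morphism in `D`, and faithfulness of `F` shows that
appending `w` again gives back the later one in `C` (`IsImage.of_envRel_symm`). Surjectivity follows
directly from the normal form. -/

/-- In a symmetric monoidal category, the middle-four interchange commutes with the symmetries. -/
theorem tensorμ_braiding {C : Type u} [Category.{v} C] [MonoidalCategory C] [SymmetricCategory C]
    (X₁ X₂ Y₁ Y₂ : C) :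
    tensorμ X₁ X₂ Y₁ Y₂ ≫ ((β_ X₁ Y₁).hom ⊗ₘ (β_ X₂ Y₂).hom) =
      (β_ (X₁ ⊗ X₂) (Y₁ ⊗ Y₂)).hom ≫ tensorμ Y₁ Y₂ X₁ X₂ := by
  simp [tensorμ, SymmetricCategory.braiding_swap_eq_inv_braiding X₁ Y₂, MonoidalCategory.tensorHom_def]

/-- A morphism `X ⟶ Y` in `P` between the environments carries the first morphism to the second. -/
def EnvRel {C : Type u} [Category.{v} C] [MonoidalCategory C] (P : MorphismProperty C) {A B : C}
    (p q : Σ X : C, A ⟶ B ⊗ X) : Prop :=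
  ∃ u : p.1 ⟶ q.1, P u ∧ p.2 ≫ B ◁ u = q.2

/-- The category with the objects of `C`, in which a morphism from `A` to `B` is a morphism
`A ⟶ B ⊗ X` of `C` for some environment `X`, up to the morphisms in `P` between environments. -/
structure EnvCat {C : Type u} [Category.{v} C] (P : MorphismProperty C) : Type u where
  as : C

namespace EnvCat

variable {C : Type u} [Category.{v} C] [MonoidalCategory C] (P : MorphismProperty C)

variable {P} in
theorem quot_mk_eq {A B X Y : C} {f : A ⟶ B ⊗ X} {g : A ⟶ B ⊗ Y} (u : X ⟶ Y) (hu : P u)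
    (h : f ≫ B ◁ u = g) : Quot.mk (EnvRel P) ⟨X, f⟩ = Quot.mk (EnvRel P) ⟨Y, g⟩ :=
  Quot.sound ⟨u, hu, h⟩

section

variable [P.IsMonoidalStable]

theorem envRel_comp_right {A B D : C} (p : Σ X : C, A ⟶ B ⊗ X) (q q' : Σ X : C, B ⟶ D ⊗ X)
    (h : EnvRel P q q') :
    EnvRel P ⟨q.1 ⊗ p.1, p.2 ≫ q.2 ▷ p.1 ≫ (α_ D q.1 p.1).hom⟩
      ⟨q'.1 ⊗ p.1, p.2 ≫ q'.2 ▷ p.1 ≫ (α_ D q'.1 p.1).hom⟩ := by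
  obtain ⟨u, hu, h⟩ := h
  exact ⟨u ▷ p.1, P.whiskerRight_mem _ hu _, by simp [← h]⟩

/-- The map `u` acts on the environment while `q` acts on the system, so the two commute by the
exchange law. -/
theorem envRel_comp_left {A B D : C} (p p' : Σ X : C, A ⟶ B ⊗ X) (q : Σ X : C, B ⟶ D ⊗ X)
    (h : EnvRel P p p') :
    EnvRel P ⟨q.1 ⊗ p.1, p.2 ≫ q.2 ▷ p.1 ≫ (α_ D q.1 p.1).hom⟩
      ⟨q.1 ⊗ p'.1, p'.2 ≫ q.2 ▷ p'.1 ≫ (α_ D q.1 p'.1).hom⟩ := by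
  obtain ⟨u, hu, h⟩ := h
  refine ⟨q.1 ◁ u, P.whiskerLeft_mem _ _ hu, ?_⟩
  simp only [← h, Category.assoc, whisker_exchange_assoc]
  simp

/-- The environment of the later factor is placed to the left, so a composite needs only an
associator and no symmetry. The category laws hold up to unitors and associators of environments,
which belong to `P`. -/
instance : Category.{max u v} (EnvCat P) where
  Hom A B := Quot (EnvRel P (A := A.as) (B := B.as))
  id A := Quot.mk _ ⟨𝟙_ C, (ρ_ A.as).inv⟩
  comp {_ _ D} f g := Quot.map₂ (fun p q => ⟨q.1 ⊗ p.1, p.2 ≫ q.2 ▷ p.1 ≫ (α_ D.as q.1 p.1).hom⟩)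
    (envRel_comp_right P) (envRel_comp_left P) f g
  id_comp := by
    rintro A B ⟨X, f⟩
    exact quot_mk_eq (ρ_ X).hom (P.rightUnitor_hom_mem X) (by simp)
  comp_id := by
    rintro A B ⟨X, f⟩
    exact quot_mk_eq (λ_ X).hom (P.leftUnitor_hom_mem X) (by simp)
  assoc := by
    rintro A B D E ⟨X, f⟩ ⟨Y, g⟩ ⟨Z, h⟩
    exact quot_mk_eq (α_ Z Y X).inv (P.associator_inv_mem Z Y X) (by simp)

/-- The class of a morphism with an environment. -/
def homMk {A B X : C} (f : A ⟶ B ⊗ X) : (⟨A⟩ : EnvCat P) ⟶ ⟨B⟩ := Quot.mk (EnvRel P) ⟨X, f⟩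

variable {P} in
theorem homMk_eq {A B X Y : C} {f : A ⟶ B ⊗ X} {g : A ⟶ B ⊗ Y} (u : X ⟶ Y) (hu : P u)
    (h : f ≫ B ◁ u = g) : homMk P f = homMk P g :=
  quot_mk_eq u hu h

theorem homMk_comp_homMk {A B D X Y : C} (f : A ⟶ B ⊗ X) (g : B ⟶ D ⊗ Y) :
    homMk P f ≫ homMk P g = homMk P (f ≫ g ▷ X ≫ (α_ D Y X).hom) := rfl

/-- The inclusion of `C`, with trivial environments. -/
def incl : C ⥤ EnvCat P where
  obj A := ⟨A⟩
  map {_ B} f := homMk P (f ≫ (ρ_ B).inv)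
  map_id A := by rw [Category.id_comp]; rfl
  map_comp f g := Eq.symm <| by
    rw [homMk_comp_homMk]
    exact homMk_eq (λ_ (𝟙_ C)).hom (P.leftUnitor_hom_mem _) (by simp)

theorem incl_comp_homMk {A B D X : C} (f : A ⟶ B) (g : B ⟶ D ⊗ X) :
    (incl P).map f ≫ homMk P g = homMk P (f ≫ g) := by
  refine (homMk_comp_homMk P _ _).trans (homMk_eq (ρ_ X).hom (P.rightUnitor_hom_mem X) ?_)
  simp

theorem homMk_comp_incl {A B D X : C} (f : A ⟶ B ⊗ X) (g : B ⟶ D) :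
    homMk P f ≫ (incl P).map g = homMk P (f ≫ g ▷ X) := by
  refine (homMk_comp_homMk P _ _).trans (homMk_eq (λ_ X).hom (P.leftUnitor_hom_mem X) ?_)
  simp

end

/-! ### The symmetric monoidal structure on morphisms with an environment. -/

variable [SymmetricCategory C] [P.IsStableUnderBraiding]

/-- The wide subcategory on `P` is itself symmetric monoidal, and its interchange map is that of `C`
together with a proof of membership. -/
theorem tensorμ_mem (X₁ X₂ Y₁ Y₂ : C) : P (tensorμ X₁ X₂ Y₁ Y₂) :=
  (tensorμ (C := WideSubcategory P) ⟨X₁⟩ ⟨X₂⟩ ⟨Y₁⟩ ⟨Y₂⟩).property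

theorem envRel_tensor_right {A B A' B' : C} (p : Σ X : C, A ⟶ B ⊗ X)
    (q q' : Σ X : C, A' ⟶ B' ⊗ X) (h : EnvRel P q q') :
    EnvRel P ⟨p.1 ⊗ q.1, (p.2 ⊗ₘ q.2) ≫ tensorμ B p.1 B' q.1⟩
      ⟨p.1 ⊗ q'.1, (p.2 ⊗ₘ q'.2) ≫ tensorμ B p.1 B' q'.1⟩ := by
  obtain ⟨u, hu, h⟩ := h
  refine ⟨p.1 ◁ u, P.whiskerLeft_mem _ _ hu, ?_⟩
  have := tensorμ_natural (𝟙 B) (𝟙 p.1) (𝟙 B') u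
  simp only [id_tensorHom, tensorHom_id, id_whiskerRight] at this
  simp only [← h, Category.assoc, ← this]
  simp [MonoidalCategory.tensorHom_def]

theorem envRel_tensor_left {A B A' B' : C} (p p' : Σ X : C, A ⟶ B ⊗ X)
    (q : Σ X : C, A' ⟶ B' ⊗ X) (h : EnvRel P p p') :
    EnvRel P ⟨p.1 ⊗ q.1, (p.2 ⊗ₘ q.2) ≫ tensorμ B p.1 B' q.1⟩
      ⟨p'.1 ⊗ q.1, (p'.2 ⊗ₘ q.2) ≫ tensorμ B p'.1 B' q.1⟩ := by
  obtain ⟨u, hu, h⟩ := h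
  refine ⟨u ▷ q.1, P.whiskerRight_mem _ hu _, ?_⟩
  have := tensorμ_natural (𝟙 B) u (𝟙 B') (𝟙 q.1)
  simp only [id_tensorHom, tensorHom_id, id_whiskerRight] at this
  simp only [← h, Category.assoc, ← this]
  simp [MonoidalCategory.tensorHom_def']

/-- The tensor product of morphisms with an environment. -/
def tensor {A B A' B' : EnvCat P} (f : A ⟶ B) (g : A' ⟶ B') :
    (⟨A.as ⊗ A'.as⟩ : EnvCat P) ⟶ ⟨B.as ⊗ B'.as⟩ :=
  Quot.map₂ (fun p q => ⟨p.1 ⊗ q.1, (p.2 ⊗ₘ q.2) ≫ tensorμ B.as p.1 B'.as q.1⟩)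
    (envRel_tensor_right P) (envRel_tensor_left P) f g

instance : MonoidalCategoryStruct (EnvCat P) where
  tensorObj A B := ⟨A.as ⊗ B.as⟩
  tensorUnit := ⟨𝟙_ C⟩
  tensorHom f g := tensor P f g
  whiskerLeft A _ _ g := tensor P (𝟙 A) g
  whiskerRight f B := tensor P f (𝟙 B)
  associator X Y Z := (incl P).mapIso (α_ X.as Y.as Z.as)
  leftUnitor X := (incl P).mapIso (λ_ X.as)
  rightUnitor X := (incl P).mapIso (ρ_ X.as)

theorem homMk_tensor_homMk {A B A' B' X X' : C} (f : A ⟶ B ⊗ X) (g : A' ⟶ B' ⊗ X') :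
    homMk P f ⊗ₘ homMk P g = homMk P ((f ⊗ₘ g) ≫ tensorμ B X B' X') := rfl

theorem incl_map_tensor {A B A' B' : C} (f : A ⟶ B) (g : A' ⟶ B') :
    (incl P).map (f ⊗ₘ g) = (incl P).map f ⊗ₘ (incl P).map g := by
  refine Eq.symm ((homMk_tensor_homMk P _ _).trans (homMk_eq (λ_ (𝟙_ C)).hom (P.leftUnitor_hom_mem _) ?_))
  -- After composing with this unitor, the interchange map with unit environments is handled by the
  -- coherence law `rightUnitor_monoidal`.
  rw [← cancel_mono (ρ_ (B ⊗ B')).hom, Category.assoc, Category.assoc, Category.assoc,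
    ← rightUnitor_monoidal]
  simp

instance : MonoidalCategory (EnvCat P) :=
  MonoidalCategory.ofTensorHom
    (id_tensorHom_id := fun X Y => by
      have h := incl_map_tensor P (𝟙 X.as) (𝟙 Y.as)
      rw [id_tensorHom_id, CategoryTheory.Functor.map_id, CategoryTheory.Functor.map_id,
        CategoryTheory.Functor.map_id] at h
      exact h.symm)
    (id_tensorHom := fun _ _ _ _ => rfl)
    (tensorHom_id := fun _ _ => rfl)
    (tensorHom_comp_tensorHom := by
      rintro ⟨A⟩ ⟨B⟩ ⟨D⟩ ⟨A'⟩ ⟨B'⟩ ⟨D'⟩ ⟨X, f⟩ ⟨X', f'⟩ ⟨Y, g⟩ ⟨Y', g'⟩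
      change (homMk P f ⊗ₘ homMk P f') ≫ (homMk P g ⊗ₘ homMk P g') = (homMk P f ≫ homMk P g) ⊗ₘ (homMk P f' ≫ homMk P g')
      simp only [homMk_comp_homMk, homMk_tensor_homMk]
      -- The two sides have the same four environments in different orders; the interchange map on
      -- environments reconciles them.
      refine Eq.symm (homMk_eq (tensorμ Y X Y' X') (tensorμ_mem P _ _ _ _) ?_)
      simp only [← tensorHom_comp_tensorHom, Category.assoc, comp_whiskerRight]
      have h := tensorμ_natural g (𝟙 X) g' (𝟙 X')
      simp only [tensorHom_id, id_whiskerRight] at h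
      rw [← associator_monoidal, reassoc_of% h])
    (associator_naturality := by
      rintro ⟨A⟩ ⟨A'⟩ ⟨A''⟩ ⟨B⟩ ⟨B'⟩ ⟨B''⟩ ⟨X, f⟩ ⟨X', f'⟩ ⟨X'', f''⟩
      change ((homMk P f ⊗ₘ homMk P f') ⊗ₘ homMk P f'') ≫ (incl P).map (α_ B B' B'').hom =
        (incl P).map (α_ A A' A'').hom ≫ (homMk P f ⊗ₘ (homMk P f' ⊗ₘ homMk P f''))
      simp only [homMk_tensor_homMk]
      refine (homMk_comp_incl P _ _).trans (Eq.trans ?_ (incl_comp_homMk P _ _).symm)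
      refine homMk_eq (α_ X X' X'').hom (P.associator_hom_mem _ _ _) ?_
      have h := tensor_associativity B X B' X' B'' X''
      have h1 : ((f ⊗ₘ f') ≫ tensorμ B X B' X') ⊗ₘ f'' =
          ((f ⊗ₘ f') ⊗ₘ f'') ≫ tensorμ B X B' X' ▷ (B'' ⊗ X'') := by
        rw [← tensorHom_id, tensorHom_comp_tensorHom, Category.comp_id]
      have h2 : f ⊗ₘ ((f' ⊗ₘ f'') ≫ tensorμ B' X' B'' X'') =
          (f ⊗ₘ (f' ⊗ₘ f'')) ≫ (B ⊗ X) ◁ tensorμ B' X' B'' X'' := by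
        rw [← id_tensorHom, tensorHom_comp_tensorHom, Category.comp_id]
      rw [h1, h2]
      simp only [Category.assoc, ← MonoidalCategory.tensorHom_def, h, associator_naturality_assoc])
    (leftUnitor_naturality := by
      rintro ⟨A⟩ ⟨B⟩ ⟨X, f⟩
      change (homMk P (ρ_ (𝟙_ C)).inv ⊗ₘ homMk P f) ≫ (incl P).map (λ_ B).hom =
        (incl P).map (λ_ A).hom ≫ homMk P f
      simp only [homMk_tensor_homMk]
      refine (homMk_comp_incl P _ _).trans (Eq.trans ?_ (incl_comp_homMk P _ _).symm)
      refine homMk_eq (λ_ X).hom (P.leftUnitor_hom_mem _) ?_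
      have h := tensor_left_unitality B X
      rw [Category.assoc, Category.assoc, ← MonoidalCategory.tensorHom_def, ← leftUnitor_naturality, h,
        ← unitors_inv_equal]
      simp [MonoidalCategory.tensorHom_def'])
    (rightUnitor_naturality := by
      rintro ⟨A⟩ ⟨B⟩ ⟨X, f⟩
      change (homMk P f ⊗ₘ homMk P (ρ_ (𝟙_ C)).inv) ≫ (incl P).map (ρ_ B).hom =
        (incl P).map (ρ_ A).hom ≫ homMk P f
      simp only [homMk_tensor_homMk]
      refine (homMk_comp_incl P _ _).trans (Eq.trans ?_ (incl_comp_homMk P _ _).symm)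
      refine homMk_eq (ρ_ X).hom (P.rightUnitor_hom_mem _) ?_
      have h := tensor_right_unitality B X
      rw [Category.assoc, Category.assoc, ← MonoidalCategory.tensorHom_def, ← rightUnitor_naturality, h,
        ← unitors_inv_equal]
      simp [MonoidalCategory.tensorHom_def])
    (pentagon := fun W X Y Z => by
      have h := congrArg (incl P).map (MonoidalCategory.pentagon W.as X.as Y.as Z.as)
      rw [← id_tensorHom, ← tensorHom_id] at h
      simp only [Functor.map_comp, incl_map_tensor, CategoryTheory.Functor.map_id] at h
      exact h)
    (triangle := fun X Y => by
      have h := congrArg (incl P).map (MonoidalCategory.triangle X.as Y.as)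
      rw [← id_tensorHom, ← tensorHom_id] at h
      simp only [Functor.map_comp, incl_map_tensor, CategoryTheory.Functor.map_id] at h
      exact h)

theorem incl_map_whiskerRight {X Y : C} (f : X ⟶ Y) (Z : C) :
    (incl P).map (f ▷ Z) = (incl P).map f ▷ (incl P).obj Z := by
  rw [← tensorHom_id, incl_map_tensor, CategoryTheory.Functor.map_id, tensorHom_id]

theorem incl_map_whiskerLeft (Z : C) {X Y : C} (f : X ⟶ Y) :
    (incl P).map (Z ◁ f) = (incl P).obj Z ◁ (incl P).map f := by
  rw [← id_tensorHom, incl_map_tensor, CategoryTheory.Functor.map_id, id_tensorHom]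

/-- Swapping the systems also swaps the environments. The symmetry of the environments lies in `P`,
and `tensorμ_braiding` matches the two swaps. -/
theorem tensor_comp_braiding {A B A' B' : EnvCat P} (f : A ⟶ B) (g : A' ⟶ B') :
    (f ⊗ₘ g) ≫ (incl P).map (β_ B.as B'.as).hom =
      (incl P).map (β_ A.as A'.as).hom ≫ (g ⊗ₘ f) := by
  obtain ⟨X, f⟩ := f
  obtain ⟨X', g⟩ := g
  change (homMk P f ⊗ₘ homMk P g) ≫ _ = _ ≫ (homMk P g ⊗ₘ homMk P f)
  simp only [homMk_tensor_homMk]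
  refine (homMk_comp_incl P _ _).trans (Eq.trans ?_ (incl_comp_homMk P _ _).symm)
  refine homMk_eq (β_ X X').hom (MorphismProperty.IsStableUnderBraiding.braiding_hom_mem P _ _) ?_
  rw [Category.assoc, Category.assoc, ← MonoidalCategory.tensorHom_def, tensorμ_braiding,
    BraidedCategory.braiding_naturality_assoc]

instance : SymmetricCategory (EnvCat P) where
  braiding X Y := (incl P).mapIso (β_ X.as Y.as)
  braiding_naturality_right X _ _ g := tensor_comp_braiding P (𝟙 X) g
  braiding_naturality_left f Z := tensor_comp_braiding P f (𝟙 Z)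
  hexagon_forward X Y Z := by
    have h := congrArg (incl P).map (BraidedCategory.hexagon_forward X.as Y.as Z.as)
    simp only [Functor.map_comp, incl_map_whiskerLeft, incl_map_whiskerRight] at h
    exact h
  hexagon_reverse X Y Z := by
    have h := congrArg (incl P).map (BraidedCategory.hexagon_reverse X.as Y.as Z.as)
    simp only [Functor.map_comp, incl_map_whiskerLeft, incl_map_whiskerRight] at h
    exact h
  symmetry X Y := by
    have h := congrArg (incl P).map (SymmetricCategory.symmetry X.as Y.as)
    simp only [Functor.map_comp, CategoryTheory.Functor.map_id] at h
    exact h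

instance : (incl P).Braided where
  toMonoidal := Functor.CoreMonoidal.toMonoidal
    { εIso := Iso.refl (𝟙_ (EnvCat P))
      μIso := fun X Y => Iso.refl ((incl P).obj X ⊗ (incl P).obj Y)
      μIso_hom_natural_left := fun f X => (Category.comp_id _).trans
        ((incl_map_whiskerRight P f X).symm.trans (Category.id_comp _).symm)
      μIso_hom_natural_right := fun X f => (Category.comp_id _).trans
        ((incl_map_whiskerLeft P X f).symm.trans (Category.id_comp _).symm)
      associativity := fun X Y Z => Extension.comp_aux _ ((incl P).map (α_ X Y Z).hom) _
        (id_whiskerRight _ _) (whiskerLeft_id _ _)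
      left_unitality := fun X => Extension.comp_aux' _ ((incl P).map (λ_ X).hom)
        (id_whiskerRight _ _)
      right_unitality := fun X => Extension.comp_aux' _ ((incl P).map (ρ_ X).hom)
        (whiskerLeft_id _ _) }
  braided _ _ := (Category.id_comp _).trans (Category.comp_id _).symm

end EnvCat

/-! ### The discard construction maps to morphisms with an environment -/

/-- The symmetry of the unit with itself is the identity; what remains is coherence without
symmetries. -/
theorem tensorμ_unit_unit {C : Type u} [Category.{v} C] [MonoidalCategory C] [BraidedCategory C]
    (B X : C) : ((ρ_ B).inv ⊗ₘ (λ_ X).inv) ≫ tensorμ B (𝟙_ C) (𝟙_ C) X =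
      (ρ_ B).inv ⊗ₘ (λ_ X).inv := by
  have h : (β_ (𝟙_ C) (𝟙_ C)).hom = 𝟙 _ := by
    rw [braiding_tensorUnit_left, unitors_equal, Iso.hom_inv_id]
  simp only [tensorμ, h]
  monoidal

/-! ### Discarding environments through a symmetric monoidal functor. -/

section DiscardedEnvironment

open Functor.LaxMonoidal Functor.OplaxMonoidal

variable {T : Type u'} [Category.{v'} T] [MonoidalCategory T]

/-- By the exchange law, discarding `X` may be postponed until after `g`, where both environments
are discarded at once. -/
theorem discard_comp_discard {B D X Y : T} (g : B ⟶ D ⊗ Y) (x : X ⟶ 𝟙_ T) (y : Y ⟶ 𝟙_ T) :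
    B ◁ x ≫ (ρ_ B).hom ≫ g ≫ D ◁ y ≫ (ρ_ D).hom =
      g ▷ X ≫ (α_ D Y X).hom ≫ D ◁ ((y ⊗ₘ x) ≫ (λ_ (𝟙_ T)).hom) ≫ (ρ_ D).hom := by
  rw [← rightUnitor_naturality_assoc, whisker_exchange_assoc]
  simp [MonoidalCategory.tensorHom_def', unitors_equal]

theorem discard_tensor_discard [SymmetricCategory T] {B B' X X' : T} (x : X ⟶ 𝟙_ T)
    (x' : X' ⟶ 𝟙_ T) :
    (B ◁ x ≫ (ρ_ B).hom) ⊗ₘ (B' ◁ x' ≫ (ρ_ B').hom) =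
      tensorμ B X B' X' ≫ (B ⊗ B') ◁ ((x ⊗ₘ x') ≫ (λ_ (𝟙_ T)).hom) ≫ (ρ_ (B ⊗ B')).hom := by
  have h := tensorμ_natural (𝟙 B) x (𝟙 B') x'
  simp only [id_tensorHom] at h
  rw [← tensorHom_comp_tensorHom, rightUnitor_monoidal, reassoc_of% h]
  simp

variable [SymmetricCategory T] {C : Type u} [Category.{v} C] [MonoidalCategory C]
  [SymmetricCategory C] (Φ : C ⥤ T) [Φ.Braided] (d : ∀ X : C, Φ.obj X ⟶ 𝟙_ T)

/-- The image of a morphism under a functor, with the environment discarded. -/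
def discardEnv {A B X : C} (f : A ⟶ B ⊗ X) : Φ.obj A ⟶ Φ.obj B :=
  Φ.map f ≫ δ Φ B X ≫ Φ.obj B ◁ d X ≫ (ρ_ (Φ.obj B)).hom

theorem discardEnv_comp_whiskerLeft {A B X Y : C} (f : A ⟶ B ⊗ X) (u : X ⟶ Y)
    (hu : Φ.map u ≫ d Y = d X) : discardEnv Φ d (f ≫ B ◁ u) = discardEnv Φ d f := by
  simp only [discardEnv, ← hu, Functor.map_comp, Category.assoc, whiskerLeft_comp,
    δ_natural_right_assoc]

theorem discardEnv_comp_rightUnitor_inv (h : d (𝟙_ C) = η Φ) {A B : C} (f : A ⟶ B) :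
    discardEnv Φ d (f ≫ (ρ_ B).inv) = Φ.map f := by
  simp [discardEnv, h]

/-- The extreme case in which the whole system is environment; it shows that the discard maps
themselves have the normal form. -/
theorem discardEnv_leftUnitor_inv (X : C) : discardEnv Φ d (λ_ X).inv ≫ η Φ = d X := by
  rw [discardEnv]
  simp only [Category.assoc]
  rw [← rightUnitor_naturality, whisker_exchange_assoc, ← unitors_equal, leftUnitor_naturality,
    Functor.Monoidal.map_leftUnitor_inv]
  simp

/-- The right side is what interpreting the formal term "apply `f`, discard `X`, remove the unit"
unfolds to. A generator is interpreted with target `Φ.obj (𝟙_ C)`, hence the correction by `η`. -/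
theorem discardEnv_comp_η {A B X : C} (f : A ⟶ B ⊗ X) (m : ∀ X, Φ.obj X ⟶ Φ.obj (𝟙_ C)) :
    discardEnv Φ (fun X => m X ≫ η Φ) f = Φ.map f ≫ Φ.map (𝟙 _) ≫
      (δ Φ _ _ ≫ (Φ.map (𝟙 B) ⊗ₘ m X) ≫ μ Φ _ _) ≫ Φ.map (ρ_ B).hom := by
  rw [Functor.Monoidal.map_rightUnitor]
  simp [discardEnv]

theorem discardEnv_comp_discardEnv
    (h : ∀ X Y, d (X ⊗ Y) = δ Φ X Y ≫ (d X ⊗ₘ d Y) ≫ (λ_ (𝟙_ T)).hom)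
    {A B D X Y : C} (f : A ⟶ B ⊗ X) (g : B ⟶ D ⊗ Y) :
    discardEnv Φ d f ≫ discardEnv Φ d g = discardEnv Φ d (f ≫ g ▷ X ≫ (α_ D Y X).hom) := by
  have := discard_comp_discard (Φ.map g ≫ δ Φ D Y) (d X) (d Y)
  simp only [Category.assoc] at this
  simp only [discardEnv, Category.assoc, this, h]
  simp

theorem discardEnv_tensor_discardEnv
    (h : ∀ X Y, d (X ⊗ Y) = δ Φ X Y ≫ (d X ⊗ₘ d Y) ≫ (λ_ (𝟙_ T)).hom)
    {A B A' B' X X' : C} (f : A ⟶ B ⊗ X) (g : A' ⟶ B' ⊗ X') :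
    δ Φ A A' ≫ (discardEnv Φ d f ⊗ₘ discardEnv Φ d g) ≫ μ Φ B B' =
      discardEnv Φ d ((f ⊗ₘ g) ≫ tensorμ B X B' X') := by
  have h1 : discardEnv Φ d f ⊗ₘ discardEnv Φ d g =
      (Φ.map f ⊗ₘ Φ.map g) ≫ (δ Φ B X ⊗ₘ δ Φ B' X') ≫
        ((Φ.obj B ◁ d X ≫ (ρ_ (Φ.obj B)).hom) ⊗ₘ (Φ.obj B' ◁ d X' ≫ (ρ_ (Φ.obj B')).hom)) := by
    simp only [discardEnv, tensorHom_comp_tensorHom]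
  have h2 : Φ.map (tensorμ B X B' X') =
      δ Φ _ _ ≫ (δ Φ B X ⊗ₘ δ Φ B' X') ≫ tensorμ _ _ _ _ ≫ (μ Φ B B' ⊗ₘ μ Φ X X') ≫ μ Φ _ _ := by
    rw [tensorμ_comp_μ_tensorHom_μ_comp_μ, tensorHom_comp_tensorHom_assoc]
    simp
  rw [h1, discard_tensor_discard, discardEnv, Functor.map_comp, h2, Functor.Monoidal.map_tensor, h]
  generalize (d X ⊗ₘ d X') ≫ (λ_ (𝟙_ T)).hom = t
  -- On the environment, `μ` meets the `δ` coming from `h` and cancels; on the system, `μ` slides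
  -- past the discard to the end.
  have h3 : (μ Φ B B' ⊗ₘ μ Φ X X') ≫ Φ.obj (B ⊗ B') ◁ (δ Φ X X' ≫ t) ≫
      (ρ_ (Φ.obj (B ⊗ B'))).hom = (Φ.obj B ⊗ Φ.obj B') ◁ t ≫ (ρ_ _).hom ≫ μ Φ B B' := by
    rw [← rightUnitor_naturality, whisker_exchange_assoc, MonoidalCategory.tensorHom_def,
      Category.assoc, ← whiskerLeft_comp_assoc, Functor.Monoidal.μ_δ_assoc]
  simp only [Category.assoc, Functor.Monoidal.μ_δ_assoc, h3]

end DiscardedEnvironment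

/-- The inclusion of a wide symmetric monoidal subcategory is symmetric monoidal. -/
instance wideSubcategoryInclusionBraided {C : Type u} [Category.{v} C] [MonoidalCategory C]
    [SymmetricCategory C] (P : MorphismProperty C) [P.IsStableUnderBraiding] :
    (wideSubcategoryInclusion P).Braided where
  toMonoidal := Functor.CoreMonoidal.toMonoidal
    { εIso := Iso.refl (𝟙_ C)
      μIso := fun X Y => Iso.refl (X.obj ⊗ Y.obj)
      μIso_hom_natural_left := fun _ _ => (Category.comp_id _).trans (Category.id_comp _).symm
      μIso_hom_natural_right := fun _ _ => (Category.comp_id _).trans (Category.id_comp _).symm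
      associativity := fun X Y Z => Extension.comp_aux _ (α_ X.obj Y.obj Z.obj).hom _
        (id_whiskerRight _ _) (whiskerLeft_id _ _)
      left_unitality := fun X => Extension.comp_aux' _ (λ_ X.obj).hom (id_whiskerRight _ _)
      right_unitality := fun X => Extension.comp_aux' _ (ρ_ X.obj).hom (whiskerLeft_id _ _) }
  braided _ _ := (Category.id_comp _).trans (Category.comp_id _).symm

/-! ### Interpreting the affine completion by environments. -/

namespace EnvCat

variable {C : Type u} [Category.{v} C] [MonoidalCategory C] [SymmetricCategory C]
  (P : MorphismProperty C) [P.IsStableUnderBraiding]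

/-- The inclusion of the morphisms in `P`. -/
abbrev inclWide : WideSubcategory P ⥤ EnvCat P := wideSubcategoryInclusion P ⋙ incl P

/-- Discarding a system moves it to the environment. -/
def discardGen : ∀ {X Y : WideSubcategory P}, AffineGen (WideSubcategory P) X Y →
    ((inclWide P).obj X ⟶ (inclWide P).obj Y)
  | _, _, .discard A => homMk P (λ_ A.obj).inv

theorem δ_incl (X Y : C) : Functor.OplaxMonoidal.δ (incl P) X Y = 𝟙 _ := rfl

theorem μ_incl (X Y : C) : Functor.LaxMonoidal.μ (incl P) X Y = 𝟙 _ := rfl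

theorem δ_inclWide (X Y : WideSubcategory P) :
    Functor.OplaxMonoidal.δ (inclWide P) X Y = 𝟙 _ := by
  rw [Functor.OplaxMonoidal.comp_δ]
  exact (Category.comp_id _).trans ((incl P).map_id _)

theorem μ_inclWide (X Y : WideSubcategory P) :
    Functor.LaxMonoidal.μ (inclWide P) X Y = 𝟙 _ := by
  rw [Functor.LaxMonoidal.comp_μ]
  exact (Category.id_comp _).trans ((incl P).map_id _)

/-- A term of the affine completion is interpreted by a morphism in `P` with an environment. -/
theorem exists_interp_eq_homMk {X Y : WideSubcategory P}
    (t : Term (WideSubcategory P) (AffineGen (WideSubcategory P)) X Y) :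
    ∃ (Z : C) (f : X.obj ⟶ Y.obj ⊗ Z), P f ∧
      Extension.interp (inclWide P) (discardGen P) t = homMk P f := by
  induction t with
  | @of X Y f =>
    exact ⟨_, f.hom ≫ (ρ_ Y.obj).inv, P.comp_mem _ _ f.property (P.rightUnitor_inv_mem _), rfl⟩
  | gen g =>
    obtain ⟨A⟩ := g
    exact ⟨_, _, P.leftUnitor_inv_mem _, rfl⟩
  | comp s t ihs iht =>
    obtain ⟨Z, f, hf, hs⟩ := ihs
    obtain ⟨Z', f', hf', ht⟩ := iht
    refine ⟨_, _, ?_, (congr (congrArg _ hs) ht).trans (homMk_comp_homMk P f f')⟩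
    exact P.comp_mem _ _ hf (P.comp_mem _ _ (P.whiskerRight_mem _ hf' _) (P.associator_hom_mem _ _ _))
  | tensor s t ihs iht =>
    obtain ⟨Z, f, hf, hs⟩ := ihs
    obtain ⟨Z', f', hf', ht⟩ := iht
    refine ⟨_, _, ?_, Eq.trans ?_ (homMk_tensor_homMk P f f')⟩
    · exact P.comp_mem _ _ (P.tensorHom_mem _ _ hf hf') (tensorμ_mem P _ _ _ _)
    · rw [Extension.interp, δ_inclWide, μ_inclWide, hs, ht]
      exact (Category.id_comp _).trans (Category.comp_id _)

/-- A term into the unit is represented by some `f` in `P` from `A` to `𝟙 ⊗ Z`. Up to a unitor, `f`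
is then itself a morphism in `P` from the environment `A` to the environment `Z`, and it carries the
discard of `A` to the given term. This needs the representative to lie in `P`, which
`exists_interp_eq_homMk` supplies. -/
theorem interp_eq_of_affineRel {X Y : WideSubcategory P}
    {s t : Term (WideSubcategory P) (AffineGen (WideSubcategory P)) X Y}
    (h : AffineRel (WideSubcategory P) s t) :
    Extension.interp (inclWide P) (discardGen P) s =
      Extension.interp (inclWide P) (discardGen P) t := by
  obtain ⟨t⟩ := h
  obtain ⟨Z, f, hf, ht⟩ := exists_interp_eq_homMk P t
  rw [ht]
  refine Eq.symm (homMk_eq (f ≫ (λ_ Z).hom) (P.comp_mem _ _ hf (P.leftUnitor_hom_mem _)) ?_)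
  refine (leftUnitor_inv_naturality _).symm.trans ?_
  exact (Category.assoc _ _ _).trans ((congrArg _ (λ_ Z).hom_inv_id).trans (Category.comp_id f))

/-- The functor from the affine completion of the category of morphisms in `P`. -/
def ofAffine : Affine (WideSubcategory P) ⥤ EnvCat P :=
  Extension.lift (inclWide P) (discardGen P) (interp_eq_of_affineRel P)

theorem ofAffine_map_tensor {X Y X' Y' : Affine (WideSubcategory P)} (f : X ⟶ Y) (g : X' ⟶ Y') :
    (ofAffine P).map (f ⊗ₘ g) = (ofAffine P).map f ⊗ₘ (ofAffine P).map g := by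
  refine (Extension.lift_map_tensor (inclWide P) (discardGen P) (interp_eq_of_affineRel P)
    f g).trans ?_
  rw [δ_inclWide, μ_inclWide]
  exact (Category.id_comp _).trans (Category.comp_id _)

end EnvCat

/-! ### Normal forms in the discard construction and their comparison with environments. -/

namespace Discard

section

variable (C : Type u) [Category.{v} C] [MonoidalCategory C] [SymmetricCategory C]
  [StrictMonoidal C] [DaggerSymmetric C]

/-- The functor that presents a morphism of the discard construction as a morphism of `C` with a
discarded environment. -/
def toEnvCat : Discard C ⥤ EnvCat (isometries C) :=
  Extension.lift (EnvCat.incl (isometries C)) (fun g => (EnvCat.ofAffine (isometries C)).map g) (by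
    rintro _ _ _ _ (⟨f, g⟩ | ⟨f, g⟩ | f)
    · exact (EnvCat.ofAffine (isometries C)).map_comp f g
    · refine (EnvCat.ofAffine_map_tensor (isometries C) f g).trans ?_
      exact ((Category.id_comp _).trans (Category.comp_id _)).symm
    · rfl)

variable {C}

/-- The discard map. -/
def ground (X : C) : (incl C).obj X ⟶ 𝟙_ (Discard C) :=
  (inclAffine C).map (Affine.discard (⟨X⟩ : IsometryCat C))

theorem inclAffine_unit_ext {X : C} (f g : DiscardGen C X (𝟙_ C)) :
    (inclAffine C).map f = (inclAffine C).map g :=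
  congrArg (inclAffine C).map (Affine.hom_unit_ext f g)

theorem incl_map_isometry {X Y : IsometryCat C} (u : X ⟶ Y) :
    (incl C).map u.hom = (inclAffine C).map ((Affine.incl (IsometryCat C)).map u) :=
  (Quotient.sound (TermRel.rel (DiscardRel.glue u))).symm

/-- An isometry also lives in the affine completion, where the unit is terminal. -/
theorem incl_map_comp_ground {X Y : C} (u : X ⟶ Y) (hu : isometries C u) :
    (incl C).map u ≫ ground Y = ground X := by
  let u' : (⟨X⟩ : IsometryCat C) ⟶ ⟨Y⟩ := ⟨u, hu⟩
  refine (congrArg (· ≫ ground Y) (incl_map_isometry u')).trans ?_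
  exact ((inclAffine C).map_comp ((Affine.incl (IsometryCat C)).map u')
    (Affine.discard (⟨Y⟩ : IsometryCat C))).symm.trans (inclAffine_unit_ext _ _)

/-- Here and in `ground_tensor`, both sides come from maps into the terminal unit of the affine
completion. -/
theorem ground_unit : ground (𝟙_ C) = Functor.OplaxMonoidal.η (incl C) :=
  (inclAffine_unit_ext (Affine.discard (𝟙_ (IsometryCat C))) (𝟙 _)).trans
    ((inclAffine C).map_id ⟨⟨𝟙_ C⟩⟩)

theorem ground_tensor (X Y : C) :
    ground (X ⊗ Y) = Functor.OplaxMonoidal.δ (incl C) X Y ≫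
      (ground X ⊗ₘ ground Y) ≫ (λ_ (𝟙_ (Discard C))).hom := by
  let dX := Affine.discard (⟨X⟩ : IsometryCat C)
  let dY := Affine.discard (⟨Y⟩ : IsometryCat C)
  let l := (Affine.incl (IsometryCat C)).map (λ_ (𝟙_ (IsometryCat C))).hom
  refine Eq.trans ?_ (Category.id_comp _).symm
  refine Eq.trans ?_ (congr (congrArg CategoryStruct.comp (inclAffine_map_tensor C dX dY))
    (incl_map_isometry (λ_ (𝟙_ (IsometryCat C))).hom).symm)
  exact (inclAffine_unit_ext _ ((dX ⊗ₘ dY) ≫ l)).trans ((inclAffine C).map_comp (dX ⊗ₘ dY) l)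

/-- Discard the environment of a morphism of `C`. -/
abbrev traceOut {A B X : C} (f : A ⟶ B ⊗ X) : (incl C).obj A ⟶ (incl C).obj B :=
  discardEnv (incl C) ground f

theorem traceOut_comp_whiskerLeft {A B X Y : C} (f : A ⟶ B ⊗ X) (u : X ⟶ Y)
    (hu : isometries C u) : traceOut (f ≫ B ◁ u) = traceOut f :=
  discardEnv_comp_whiskerLeft _ _ f u (incl_map_comp_ground u hu)

theorem traceOut_leftUnitor_inv (X : C) : traceOut (λ_ X).inv = ground X :=
  (Category.comp_id _).symm.trans (discardEnv_leftUnitor_inv (incl C) ground X)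

theorem traceOut_comp_traceOut {A B D X Y : C} (f : A ⟶ B ⊗ X) (g : B ⟶ D ⊗ Y) :
    traceOut f ≫ traceOut g = traceOut (f ≫ g ▷ X ≫ (α_ D Y X).hom) :=
  discardEnv_comp_discardEnv _ _ ground_tensor f g

theorem traceOut_tensor_traceOut {A B A' B' X X' : C} (f : A ⟶ B ⊗ X) (g : A' ⟶ B' ⊗ X') :
    traceOut f ⊗ₘ traceOut g = traceOut ((f ⊗ₘ g) ≫ tensorμ B X B' X') :=
  ((Category.id_comp _).trans (Category.comp_id _)).symm.trans
    (discardEnv_tensor_discardEnv _ _ ground_tensor f g)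

/-- The generators of the discard construction are themselves classes of terms, so the normal form
is needed first for these inner terms, then for the outer ones in `exists_hom_eq_traceOut`. -/
theorem exists_inclAffine_map_eq_traceOut {X Y : IsometryCat C}
    (t : Term (IsometryCat C) (AffineGen (IsometryCat C)) X Y) :
    ∃ (Z : C) (f : X.obj ⟶ Y.obj ⊗ Z),
      (inclAffine C).map (Extension.hom (AffineRel (IsometryCat C)) t) = traceOut f := by
  induction t with
  | of f =>
    exact ⟨_, _, (incl_map_isometry f).symm.trans
      (discardEnv_comp_rightUnitor_inv _ _ ground_unit f.hom).symm⟩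
  | gen g =>
    obtain ⟨A⟩ := g
    exact ⟨_, _, (traceOut_leftUnitor_inv _).symm⟩
  | comp s t ihs iht =>
    obtain ⟨Z, f, hf⟩ := ihs
    obtain ⟨Z', f', hf'⟩ := iht
    exact ⟨_, _, ((inclAffine C).map_comp (Extension.hom _ s) (Extension.hom _ t)).trans
      ((congr (congrArg CategoryStruct.comp hf) hf').trans (traceOut_comp_traceOut f f'))⟩
  | tensor s t ihs iht =>
    obtain ⟨Z, f, hf⟩ := ihs
    obtain ⟨Z', f', hf'⟩ := iht
    exact ⟨_, _, (inclAffine_map_tensor C (Extension.hom _ s) (Extension.hom _ t)).trans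
      ((congr (congrArg MonoidalCategoryStruct.tensorHom hf) hf').trans
        (traceOut_tensor_traceOut f f'))⟩

/-- Normal forms include all generators and are closed under composition and tensor, where the
environments are collected into one. -/
theorem exists_hom_eq_traceOut {A B : C} (s : Term C (DiscardGen C) A B) :
    ∃ (X : C) (f : A ⟶ B ⊗ X), Extension.hom (DiscardRel C) s = traceOut f := by
  induction s with
  | of f => exact ⟨_, _, (discardEnv_comp_rightUnitor_inv (incl C) ground ground_unit f).symm⟩
  | gen g =>
    obtain ⟨t⟩ := g
    exact exists_inclAffine_map_eq_traceOut t
  | comp s t ihs iht =>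
    obtain ⟨Z, f, hf⟩ := ihs
    obtain ⟨Z', f', hf'⟩ := iht
    exact ⟨_, _, (congr (congrArg CategoryStruct.comp hf) hf').trans (traceOut_comp_traceOut f f')⟩
  | tensor s t ihs iht =>
    obtain ⟨Z, f, hf⟩ := ihs
    obtain ⟨Z', f', hf'⟩ := iht
    exact ⟨_, _, (congr (congrArg MonoidalCategoryStruct.tensorHom hf) hf').trans
      (traceOut_tensor_traceOut f f')⟩

/-- Every morphism of the discard construction is a morphism of `C` with a discarded
environment. -/
theorem exists_eq_traceOut {A B : Discard C} (s : A ⟶ B) :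
    ∃ (X : C) (f : A.as ⟶ B.as ⊗ X), s = traceOut f := by
  obtain ⟨s⟩ := s
  exact exists_hom_eq_traceOut s

theorem lift_map_traceOut {T : Type u'} [Category.{v'} T] [MonoidalCategory T]
    [SymmetricCategory T] (Φ : C ⥤ T) [Φ.Braided]
    (γ : ∀ {X Y : C}, DiscardGen C X Y → (Φ.obj X ⟶ Φ.obj Y))
    (hR : ∀ {X Y : C} {s t : Term C (DiscardGen C) X Y}, DiscardRel C s t →
      Extension.interp Φ γ s = Extension.interp Φ γ t) {A B X : C} (f : A ⟶ B ⊗ X) :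
    (Extension.lift Φ γ hR).map (traceOut f) = discardEnv Φ
      (fun X => γ (Affine.discard (⟨X⟩ : IsometryCat C)) ≫ Functor.OplaxMonoidal.η Φ) f := by
  exact Eq.symm (discardEnv_comp_η Φ f fun X => γ (Affine.discard (⟨X⟩ : IsometryCat C)))

/-- This is what makes the normal form usable for equality: the class of `f` modulo isometries of
the environment is an invariant of the morphism that it represents. -/
theorem toEnvCat_map_traceOut {A B X : C} (f : A ⟶ B ⊗ X) :
    (toEnvCat C).map (traceOut f) = EnvCat.homMk (isometries C) f := by
  refine (lift_map_traceOut (EnvCat.incl (isometries C))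
    (fun g => (EnvCat.ofAffine (isometries C)).map g)
    (fun h => congrArg (toEnvCat C).map (Quotient.sound (TermRel.rel h))) f).trans ?_
  -- Discarding `X` out of `B ⊗ X` is represented by the identity of `B ⊗ X`; precomposing with `f`
  -- then represents `f` itself.
  have h : (EnvCat.homMk (isometries C) (ρ_ B).inv ⊗ₘ EnvCat.homMk (isometries C) (λ_ X).inv) ≫
      (EnvCat.incl (isometries C)).map (ρ_ B).hom = EnvCat.homMk (isometries C) (𝟙 (B ⊗ X)) := by
    rw [EnvCat.homMk_tensor_homMk]
    refine (EnvCat.homMk_comp_incl _ _ _).trans (EnvCat.homMk_eq (λ_ X).hom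
      (MorphismProperty.IsStableUnderUnitor.leftUnitor_hom_mem _ X) ?_)
    rw [tensorμ_unit_unit, Category.assoc, ← MonoidalCategory.tensorHom_def,
      tensorHom_comp_tensorHom, Iso.inv_hom_id, Iso.inv_hom_id, id_tensorHom_id]
  refine Eq.trans ?_ (((congrArg (_ ≫ ·) h).trans (EnvCat.incl_comp_homMk _ _ _)).trans
    (congrArg _ (Category.comp_id f)))
  refine (discardEnv_comp_η (EnvCat.incl (isometries C)) f
    fun X => (EnvCat.ofAffine (isometries C)).map (Affine.discard (⟨X⟩ : IsometryCat C))).trans ?_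
  rw [CategoryTheory.Functor.map_id, CategoryTheory.Functor.map_id, Category.id_comp,
    EnvCat.δ_incl, EnvCat.μ_incl]
  exact congrArg ((EnvCat.incl (isometries C)).map f ≫ · ≫ (EnvCat.incl (isometries C)).map
    (ρ_ B).hom) ((Category.id_comp _).trans (Category.comp_id _))

end

/-! ### The action of the induced functor on normal forms. -/

variable {C : Type u} [Category.{v} C] [MonoidalCategory C] [SymmetricCategory C]
  [StrictMonoidal C] [DaggerSymmetric C]
  {D : Type u'} [Category.{v'} D] [MonoidalCategory D] [SymmetricCategory D]
  [StrictMonoidal D] [DaggerSymmetric D]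
  (F : C ⥤ D) [F.Braided] [StrictMonoidalFunctor F] [DaggerFunctor F]

theorem map_map_traceOut {A B X : C} (f : A ⟶ B ⊗ X) :
    (map F).map (traceOut f) = traceOut (F.map f ≫ Functor.OplaxMonoidal.δ F B X) := by
  refine (lift_map_traceOut (F ⋙ incl D) (mapGen F)
    (fun h => congrArg (map F).map (Quotient.sound (TermRel.rel h))) f).trans ?_
  -- The image of a discard map is a discard map followed by the unit comparison `ε`, which `η`
  -- cancels.
  have h : mapGen F (Affine.discard (⟨X⟩ : IsometryCat C)) ≫
      Functor.OplaxMonoidal.η (F ⋙ incl D) = ground (F.obj X) := by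
    have h1 : mapGen F (Affine.discard (⟨X⟩ : IsometryCat C)) =
        ground (F.obj X) ≫ (incl D).map (Functor.LaxMonoidal.ε F) :=
      ((inclAffine D).map_comp (Affine.discard (⟨F.obj X⟩ : IsometryCat D))
        ((Affine.incl (IsometryCat D)).map (Functor.LaxMonoidal.ε (isoFunctor F)))).trans
        (congrArg (ground (F.obj X) ≫ ·)
          (incl_map_isometry (Functor.LaxMonoidal.ε (isoFunctor F))).symm)
    have h2 : (incl D).map (Functor.LaxMonoidal.ε F) ≫ Functor.OplaxMonoidal.η (F ⋙ incl D) =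
        𝟙 (𝟙_ (Discard D)) := by
      rw [Functor.OplaxMonoidal.comp_η, ← Functor.map_comp_assoc, Functor.Monoidal.ε_η,
        CategoryTheory.Functor.map_id]
      exact Category.id_comp _
    rw [h1]
    exact (Category.assoc _ _ _).trans ((congrArg (ground (F.obj X) ≫ ·) h2).trans
      (Category.comp_id _))
  simp only [discardEnv, h, Functor.comp_map, Functor.map_comp, Functor.OplaxMonoidal.comp_δ,
    Category.assoc]
  rfl

end Discard

/-! ### Lifting along a functor that is surjective on isometries -/

namespace Discard

open Functor.OplaxMonoidal

variable {C : Type u} [Category.{v} C] [MonoidalCategory C] [SymmetricCategory C]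
  [StrictMonoidal C] [DaggerSymmetric C]
  {D : Type u'} [Category.{v'} D] [MonoidalCategory D] [SymmetricCategory D]
  [StrictMonoidal D] [DaggerSymmetric D]
  (F : C ⥤ D) [DaggerFunctor F]

theorem exists_isometry_map_eq (hiso : SurjectiveFunctor (isoFunctor F)) {X Y : C}
    (u : F.obj X ⟶ F.obj Y) (hu : isometries D u) :
    ∃ w : X ⟶ Y, isometries C w ∧ F.map w = u := by
  have := hiso.2
  let u' : (isoFunctor F).obj ⟨X⟩ ⟶ (isoFunctor F).obj ⟨Y⟩ := ⟨u, hu⟩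
  obtain ⟨w, hw⟩ := (isoFunctor F).map_surjective u'
  exact ⟨w.hom, w.property, congrArg (fun z => z.hom) hw⟩

theorem surjective_obj (hiso : SurjectiveFunctor (isoFunctor F)) : Function.Surjective F.obj := by
  intro Y
  obtain ⟨X, hX⟩ := hiso.1 ⟨Y⟩
  exact ⟨X.obj, congrArg (fun Z => Z.obj) hX⟩

variable [F.Braided]

/-- A morphism of `D` with an environment is, up to an isometry of the environment, the image of a
morphism of `C` that represents `s`. -/
def IsImage {A B : C} (s : (incl C).obj A ⟶ (incl C).obj B)
    (q : Σ Y : D, F.obj A ⟶ F.obj B ⊗ Y) : Prop :=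
  ∃ (X : C) (f : A ⟶ B ⊗ X) (u : F.obj X ⟶ q.1), isometries D u ∧
    F.map f ≫ δ F B X ≫ F.obj B ◁ u = q.2 ∧ traceOut f = s

variable {F}

/-- The isometry `u` kept in `IsImage` absorbs the new one, so nothing has to be lifted in this
direction. -/
theorem IsImage.of_envRel {A B : C} {s : (incl C).obj A ⟶ (incl C).obj B}
    {p q : Σ Y : D, F.obj A ⟶ F.obj B ⊗ Y} (hp : IsImage F s p)
    (h : EnvRel (isometries D) p q) : IsImage F s q := by
  obtain ⟨X, f, u, hu, hf, hs⟩ := hp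
  obtain ⟨w, hw, hpq⟩ := h
  exact ⟨X, f, u ≫ w, isometries_comp u w hu hw, by simp [← hpq, ← hf], hs⟩

/-- When the environment is in the image of `F`, the remaining isometry lifts to `C` and can be
absorbed into the representative without changing its trace. -/
theorem IsImage.exists_eq (hiso : SurjectiveFunctor (isoFunctor F)) {A B X : C}
    {s : (incl C).obj A ⟶ (incl C).obj B} {g : F.obj A ⟶ F.obj B ⊗ F.obj X}
    (h : IsImage F s ⟨F.obj X, g⟩) :
    ∃ f : A ⟶ B ⊗ X, F.map f ≫ δ F B X = g ∧ traceOut f = s := by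
  obtain ⟨Z, f, u, hu, hf, hs⟩ := h
  obtain ⟨w, hw, rfl⟩ := exists_isometry_map_eq F hiso u hu
  refine ⟨f ≫ B ◁ w, ?_, ?_⟩
  · rw [Functor.map_comp, Category.assoc, ← δ_natural_right]
    exact hf
  · rw [← hs]
    exact traceOut_comp_whiskerLeft f w hw

/-- The heart of the argument: an edge is undone by the dagger of its isometry. That dagger need not
be an isometry, so replacing `f` by `f ≫ B ◁ w†` is justified only because `w` leads back to `f`. -/
theorem IsImage.of_envRel_symm (hF : F.Faithful) (hiso : SurjectiveFunctor (isoFunctor F))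
    {A B : C} {s : (incl C).obj A ⟶ (incl C).obj B} {p q : Σ Y : D, F.obj A ⟶ F.obj B ⊗ Y}
    (hp : IsImage F s q) (h : EnvRel (isometries D) p q) : IsImage F s p := by
  obtain ⟨Y, g⟩ := p
  obtain ⟨Y', g'⟩ := q
  obtain ⟨X, rfl⟩ := surjective_obj F hiso Y
  obtain ⟨X', rfl⟩ := surjective_obj F hiso Y'
  obtain ⟨f, hf, hs⟩ := hp.exists_eq hiso
  obtain ⟨w, hw, hg⟩ := h
  obtain ⟨w, hw', rfl⟩ := exists_isometry_map_eq F hiso w hw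
  dsimp only at hg
  have hdag : w ≫ DaggerSymmetric.dag w = 𝟙 X := hw'
  -- Since `g'` is `g` followed by `w` and `w ≫ w† = 1`, appending `w†` to `g'` returns `g`.
  have hfg : F.map (f ≫ B ◁ DaggerSymmetric.dag w) ≫ δ F B X = g := by
    rw [Functor.map_comp, Category.assoc, ← δ_natural_right, ← Category.assoc, hf, ← hg,
      Category.assoc, ← whiskerLeft_comp, ← Functor.map_comp, hdag, CategoryTheory.Functor.map_id,
      whiskerLeft_id, Category.comp_id]
  -- In general `w† ≫ w` is not the identity. The equation holds after applying `F`, because `g'`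
  -- factors through `w`, and faithfulness reflects it.
  have hff : (f ≫ B ◁ DaggerSymmetric.dag w) ≫ B ◁ w = f := by
    apply hF.map_injective
    rw [← cancel_mono (δ F B X'), hf, Functor.map_comp, Category.assoc, ← δ_natural_right,
      ← Category.assoc, hfg, hg]
  refine ⟨X, f ≫ B ◁ DaggerSymmetric.dag w, 𝟙 _, isometries_id _, ?_, ?_⟩
  · rw [whiskerLeft_id, Category.comp_id, hfg]
  · rw [← hs, ← traceOut_comp_whiskerLeft _ w hw', hff]

/-- Equality in `EnvCat` is the equivalence relation generated by `EnvRel`, so edges of a zigzag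
must be crossed both ways. -/
theorem isImage_iff_of_eqvGen (hF : F.Faithful) (hiso : SurjectiveFunctor (isoFunctor F))
    {A B : C} {s : (incl C).obj A ⟶ (incl C).obj B} {p q : Σ Y : D, F.obj A ⟶ F.obj B ⊗ Y}
    (h : Relation.EqvGen (EnvRel (isometries D)) p q) : IsImage F s p ↔ IsImage F s q := by
  induction h with
  | rel p q h => exact ⟨fun hp => hp.of_envRel h, fun hq => hq.of_envRel_symm hF hiso h⟩
  | refl p => rfl
  | symm p q _ ih => exact ih.symm
  | trans p q r _ _ ih ih' => exact ih.trans ih'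

variable [StrictMonoidalFunctor F]

theorem faithful_map (hF : F.Faithful) (hiso : SurjectiveFunctor (isoFunctor F)) :
    (map F).Faithful where
  map_injective {A B} s t h := by
    obtain ⟨X, f, rfl⟩ := exists_eq_traceOut s
    obtain ⟨X', f', rfl⟩ := exists_eq_traceOut t
    have h1 : EnvCat.homMk (isometries D) (F.map f ≫ δ F B.as X) =
        EnvCat.homMk (isometries D) (F.map f' ≫ δ F B.as X') := by
      rw [← toEnvCat_map_traceOut, ← toEnvCat_map_traceOut]
      exact congrArg (toEnvCat D).map
        ((map_map_traceOut F f).symm.trans (h.trans (map_map_traceOut F f')))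
    have h2 : IsImage F (traceOut f) ⟨F.obj X, F.map f ≫ δ F B.as X⟩ :=
      ⟨X, f, 𝟙 _, isometries_id _, by simp, rfl⟩
    -- Carry the property of representing `traceOut f` along the zigzag to the image of `f'`. This
    -- yields a `g` with the trace of `f` and the same image as `f'`, so `g = f'` by faithfulness.
    obtain ⟨g, hg, hs⟩ := ((isImage_iff_of_eqvGen hF hiso (Quot.eqvGen_exact h1)).1 h2).exists_eq
      hiso
    have hgf : g = f' := hF.map_injective ((cancel_mono (δ F B.as X')).1 hg)
    exact hs.symm.trans (congrArg (fun z => traceOut z) hgf)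

theorem surjectiveFunctor_map (hF : SurjectiveFunctor F) : SurjectiveFunctor (map F) := by
  have := hF.2
  refine ⟨fun Y => ?_, ⟨fun {A B} t => ?_⟩⟩
  · obtain ⟨X, hX⟩ := hF.1 Y.as
    exact ⟨⟨X⟩, congrArg (incl D).obj hX⟩
  · obtain ⟨Y, g, rfl⟩ := exists_eq_traceOut t
    obtain ⟨X, rfl⟩ := hF.1 Y
    -- The `μ` moves the target into the image of `F`, and cancels the `δ` introduced by
    -- `map_map_traceOut`.
    obtain ⟨f, hf⟩ := F.map_surjective (g ≫ Functor.LaxMonoidal.μ F B.as X)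
    refine ⟨traceOut f, (map_map_traceOut F f).trans (congrArg (fun z => traceOut z) ?_)⟩
    rw [hf]
    exact (Category.assoc _ _ _).trans
      ((congrArg (g ≫ ·) (Functor.Monoidal.μ_δ F B.as X)).trans (Category.comp_id g))

end Discard

theorem theorem1 {C : Type u} [Category.{v} C] [MonoidalCategory C] [SymmetricCategory C]
    [StrictMonoidal C] [DaggerSymmetric C]
    {D : Type u'} [Category.{v'} D] [MonoidalCategory D] [SymmetricCategory D]
    [StrictMonoidal D] [DaggerSymmetric D]
    (F : C ⥤ D) [F.Braided] [StrictMonoidalFunctor F] [DaggerFunctor F]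
    (hF : F.Faithful) (hiso : SurjectiveFunctor (isoFunctor F)) :
    (Discard.map F).Faithful ∧
      (SurjectiveFunctor F →
        SurjectiveFunctor (Discard.map F) ∧ (Discard.map F).Faithful) := by
  exact ⟨Discard.faithful_map hF hiso,
    fun h => ⟨Discard.surjectiveFunctor_map h, Discard.faithful_map hF hiso⟩⟩
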